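/- Let $G>0$. Consider four-dimensional Einstein–dilaton gravity, with fields a Lorentzian metric $g_{\mu\nu}$ and a scalar $\phi$ and Lagrangian $$\mathcal L=\frac{e^{-\phi}}{16\pi G}\bigl(R-2\nabla_\mu\phi\nabla^\mu\phi\bigr).$$ For parameters $p=(m,a,\phi_\infty)\in\mathbb R^3$ with $|a|<m$, let $\Phi_p$ be the Kerr metric in Boyer–Lindquist coordinates $(t,r,\theta,\varphi)$, $$ds^2=-(1-f)dt^2+\tfrac{\rho^2}{\Delta}dr^2+\rho^2d\theta^2-2fa\sin^2\theta\,dt\,d\varphi+(r^2+a^2+fa^2\sin^2\theta)\sin^2\theta\,d\varphi^2,$$ $\rho^2=r^2+a^2\cos^2\theta$, $\Delta=r^2+a^2-2mr$, $f=2mr/\rho^2$, together with the constant dilaton $\phi=\phi_\infty$. Put $r_H=m+\sqrt{m^2-a^2}$, $\Omega_H=\frac{a}{2mr_H}$, $\Omega_\infty=0$, $\kappa_H=\frac{\sqrt{m^2-a^2}}{2mr_H}$, $T_H=\frac{\kappa_H}{2\pi}$, and let $A_H$ be the area of the horizon cross section $r=r_H$. For a vector field $\xi$ and a perturbation $\delta\Phi=(h_{\mu\nu},\delta\phi)$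 of a solution $\Phi$, the charge variation is $\delta H_\xi=\oint \boldsymbol k_\xi(\delta\Phi;\Phi)$, $\boldsymbol k_\xi=\delta\boldsymbol Q_\xi-\xi\cdot\boldsymbol\Theta$ ($\delta$ does not act on $\xi$), where, with $F=e^{-\phi}$ and $h=g^{\mu\nu}h_{\mu\nu}$, $$16\pi G\,\Theta^\mu=F(\nabla_\nu h^{\mu\nu}-\nabla^\mu h)-h^{\mu\nu}\partial_\nu F+h\,\partial^\mu F-4F\,\delta\phi\,\partial^\mu\phi,$$ $$16\pi G\,Q_\xi^{\mu\nu}=F(\nabla^\nu\xi^\mu-\nabla^\mu\xi^\nu)+2(\xi^\nu\partial^\mu F-\xi^\mu\partial^\nu F)$$ are the symplectic potential and the Noether potential of $\mathcal L$. On a sphere of constant $t$ and $r$ the integrand is $\sqrt{-g}\,k^{tr}d\theta\,d\varphi$, $\sqrt{-g}\,k^{\mu\nu}=\delta(\sqrt{-g}\,Q_\xi^{\mu\nu})+\sqrt{-g}\,(\xi^\mu\Theta^\nu-\xi^\nu\Theta^\mu)$. Let $\hat\delta M,\hat\delta J,\hat\delta S_H$ be the charge variations for the parametric perturbation $\hat\delta\Phi=\sum_i\frac{\partial\Phi_p}{\partial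 p_i}\delta p_i$ and the generators $$\eta_M=\partial_t+\Omega_\infty\partial_\varphi,\qquad \eta_J=-\partial_\varphi,\qquad \eta_{S_H}=\tfrac{2\pi}{\kappa_H}(\partial_t+\Omega_H\partial_\varphi),$$ computed on any sphere of constant $t$ and constant $r>r_H$ (possibly a different sphere for each $p$). They are regarded as one-forms on the parameter space. Given a linear space $V$ of variations $\delta p$, such a one-form is called integrable along $V$ on a set $U$ of parameters if there is a function whose derivative at each $p\in U$, restricted to $V$, is the one-form restricted to $V$. Then: 1. $\Phi_p$ solves the field equations of $\mathcal L$ for $r>r_H$ (off the rotation axis), and $\eta_M,\eta_J,\eta_{S_H}$ leave $\Phi_p$ invariant. 2. $-g_{t\varphi}/g_{\varphi\varphi}$ tends to $\Omega_H$ at the horizon and to $\Omega_\infty$ at infinity; $\partial_t+\Omega_H\partial_\varphi$ becomes null at the horizon, with surface gravity $\kappa_H$; and $A_H=4\pi(r_H^2+a^2)=8\pi mr_H$. 3. The integrals converge, do not depend on the chosen sphere, and $$\hat\delta M=\tfrac{e^{-\phi_\infty}}{G}\bigl(\delta m-\tfrac m2\delta\phi_\infty\bigr),\qquad \hat\delta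 J=\tfrac{e^{-\phi_\infty}}{G}\bigl(a\,\delta m+m\,\delta a-ma\,\delta\phi_\infty\bigr),$$ $$\hat\delta S_H=\tfrac{e^{-\phi_\infty}}{G}\Bigl(\tfrac{\partial(A_H/4)}{\partial m}\delta m+\tfrac{\partial(A_H/4)}{\partial a}\delta a-\tfrac{A_H}{4}\delta\phi_\infty\Bigr).$$ 4. For every nonempty open set $U$ of such parameters and every linear space $V$ of variations containing the variation of $m$ alone, $\hat\delta M$ is integrable along $V$ on $U$ if and only if $\delta\phi_\infty=0$ on $V$. In particular $\phi_\infty$ is redundant: it violates the requirement that $\hat\delta M,\hat\delta J,\hat\delta S_H$ be integrable when it is varied along with $m$ and $a$. On the other hand, all three are integrable along $\{\delta\phi_\infty=0\}$, and each of $m$ and $a$ contributes non-trivially to at least one of them. 5. With $\delta\phi_\infty=0$, the functions whose variations are $\hat\delta M,\hat\delta J,\hat\delta S_H$ and which tend to $0$ as $(m,a)\to(0,0)$ at fixed $\phi_\infty$ are precisely $$M=\frac{m\,e^{-\phi_\infty}}{G},\qquad J=\frac{ma\,e^{-\phi_\infty}}{G},\qquad S_H=\frac{A_H\,e^{-\phi_\infty}}{4G}.$$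 6. The first law $T_H\,\hat\delta S_H=\hat\delta M-(\Omega_H-\Omega_\infty)\hat\delta J$ holds for all parametric variations, and the finite charges satisfy $T_H\,\delta S_H=\delta M-(\Omega_H-\Omega_\infty)\delta J$ for all variations of $m$ and $a$ at fixed $\phi_\infty$, with no $\delta\phi_\infty$ term. -/

import Mathlib

open Set Filter Topology MeasureTheory

noncomputable section

namespace EinsteinDilaton

/-! ### Fields on a four-dimensional coordinate patch -/

/-- Partial derivative of `f` with respect to the `i`-th coordinate. -/
def pd {n : ℕ} (i : Fin n) (f : (Fin n → ℝ) → ℝ) (x : Fin n → ℝ) : ℝ :=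
  deriv (fun s => f (Function.update x i s)) (x i)

/-- Points of the coordinate patch; in the Kerr case `x = (t, r, θ, ϕ)`. -/
abbrev Point := Fin 4 → ℝ

/-- The dynamical fields: components `g_{μν}` of a metric, and a dilaton. The same type is used
for perturbations `(δg_{μν}, δφ)`. -/
structure Fields where
  metric : Point → Matrix (Fin 4) (Fin 4) ℝ
  dilaton : Point → ℝ

/-- The field configuration `Φ + s δΦ`. -/
def Fields.perturb (Φ δΦ : Fields) (s : ℝ) : Fields where
  metric x := Φ.metric x + s • δΦ.metric x
  dilaton x := Φ.dilaton x + s * δΦ.dilaton x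

namespace Fields

variable (Φ δΦ : Fields) (x : Point)

/-- Inverse metric `g^{μν}`. -/
def inv : Matrix (Fin 4) (Fin 4) ℝ := (Φ.metric x)⁻¹

/-- Volume density `√(-g)` (the absolute value makes it signature independent). -/
def vol : ℝ := Real.sqrt |(Φ.metric x).det|

/-- Christoffel symbols `Γ^l_{μν}` of the Levi-Civita connection. -/
def christoffel (l μ ν : Fin 4) : ℝ :=
  (1 / 2) * ∑ σ, Φ.inv x l σ *
    (pd μ (fun y => Φ.metric y σ ν) x + pd ν (fun y => Φ.metric y σ μ) x
      - pd σ (fun y => Φ.metric y μ ν) x)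

/-- Ricci tensor `R_{μν}`. -/
def ricci (μ ν : Fin 4) : ℝ :=
  ∑ l, (pd l (fun y => Φ.christoffel y l μ ν) x - pd ν (fun y => Φ.christoffel y l μ l) x)
    + ∑ l, ∑ σ, (Φ.christoffel x l l σ * Φ.christoffel x σ μ ν
        - Φ.christoffel x l ν σ * Φ.christoffel x σ μ l)

/-- Ricci scalar. -/
def scalarCurvature : ℝ := ∑ μ, ∑ ν, Φ.inv x μ ν * Φ.ricci x μ ν

/-- Components `∂^μ u = g^{μα} ∂_α u` of the gradient of a function. -/
def grad (u : Point → ℝ) (μ : Fin 4) : ℝ := ∑ α, Φ.inv x μ α * pd α u x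

/-- Hessian `∇_μ ∇_ν u` of a function. -/
def hess (u : Point → ℝ) (μ ν : Fin 4) : ℝ :=
  pd μ (pd ν u) x - ∑ l, Φ.christoffel x l μ ν * pd l u x

/-- The wave operator `□ u`. -/
def box (u : Point → ℝ) : ℝ := ∑ μ, ∑ ν, Φ.inv x μ ν * Φ.hess x u μ ν

/-- `∇_μ φ ∇^μ φ`. -/
def gradSq : ℝ := ∑ μ, pd μ Φ.dilaton x * Φ.grad x Φ.dilaton μ

/-- The coupling function `e^{-φ}`. -/
def coupling (y : Point) : ℝ := Real.exp (-Φ.dilaton y)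

/-- The Lagrangian `ℒ = e^{-φ} (R - 2 ∇_μφ ∇^μφ) / (16 π G)`. -/
def lagrangian (G : ℝ) : ℝ :=
  Φ.coupling x / (16 * Real.pi * G) * (Φ.scalarCurvature x - 2 * Φ.gradSq x)

/-- Metric Euler-Lagrange expression `E_{μν}` of the Lagrangian:
`δ(√(-g) ℒ) = √(-g) (- E^{μν} δg_{μν} + E_φ δφ) + ∂_μ (√(-g) Θ^μ)`. -/
def eomMetric (G : ℝ) (μ ν : Fin 4) : ℝ :=
  1 / (16 * Real.pi * G) *
      (Φ.coupling x * Φ.ricci x μ ν - Φ.hess x Φ.coupling μ ν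
        + Φ.metric x μ ν * Φ.box x Φ.coupling
        - 2 * Φ.coupling x * (pd μ Φ.dilaton x * pd ν Φ.dilaton x))
    - 1 / 2 * Φ.metric x μ ν * Φ.lagrangian x G

/-- Dilaton Euler-Lagrange expression `E_φ`. -/
def eomDilaton (G : ℝ) : ℝ :=
  -Φ.lagrangian x G
    + 4 / (16 * Real.pi * G) * (Φ.coupling x * (Φ.box x Φ.dilaton - Φ.gradSq x))

/-- The fields solve the equations of motion on the region `D`. -/
def SolvesEOM (G : ℝ) (D : Set Point) : Prop :=
  ∀ x ∈ D, (∀ μ ν, Φ.eomMetric x G μ ν = 0) ∧ Φ.eomDilaton x G = 0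

/-- Covariant derivative `∇_γ h_{αβ}` of the metric perturbation `h = δg`. -/
def covDerivPert (γ α β : Fin 4) : ℝ :=
  pd γ (fun y => δΦ.metric y α β) x
    - ∑ l, (Φ.christoffel x l γ α * δΦ.metric x l β + Φ.christoffel x l γ β * δΦ.metric x α l)

/-- The surface term `Θ^μ(δΦ, Φ)` in the variation of the Lagrangian: with `F = e^{-φ}`,
`h_{μν} = δg_{μν}` and `h = g^{μν} h_{μν}`, one has
`16πG Θ^μ = F (∇_ν h^{μν} - ∇^μ h) - h^{μν} ∂_ν F + h ∂^μ F - 4 F δφ ∂^μ φ`. -/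
def theta (G : ℝ) (μ : Fin 4) : ℝ :=
  1 / (16 * Real.pi * G) *
    (Φ.coupling x * ∑ α, ∑ ν, ∑ β, Φ.inv x μ α * Φ.inv x ν β *
        (Φ.covDerivPert δΦ x β α ν - Φ.covDerivPert δΦ x α ν β)
      - ∑ α, Φ.inv x μ α * ∑ β, δΦ.metric x α β * Φ.grad x Φ.coupling β
      + (∑ α, ∑ β, Φ.inv x α β * δΦ.metric x α β) * Φ.grad x Φ.coupling μ
      - 4 * Φ.coupling x * δΦ.dilaton x * Φ.grad x Φ.dilaton μ)

/-- The one-form `ξ_μ = g_{μν} ξ^ν`. -/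
def flat (ξ : Point → Fin 4 → ℝ) (y : Point) (μ : Fin 4) : ℝ := ∑ l, Φ.metric y μ l * ξ y l

/-- The Noether potential `Q_ξ^{μν}`: on shell the Noether current
`J_ξ^μ = Θ^μ(𝓛_ξ Φ, Φ) - ξ^μ ℒ` equals `∇_ν Q_ξ^{μν}`. With `F = e^{-φ}`,
`16πG Q_ξ^{μν} = F (∇^ν ξ^μ - ∇^μ ξ^ν) + 2 (ξ^ν ∂^μ F - ξ^μ ∂^ν F)`;
here `∇_α ξ_β - ∇_β ξ_α` is written as `∂_α ξ_β - ∂_β ξ_α`. -/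
def noetherPotential (G : ℝ) (ξ : Point → Fin 4 → ℝ) (μ ν : Fin 4) : ℝ :=
  1 / (16 * Real.pi * G) *
    (Φ.coupling x * ∑ α, ∑ β, Φ.inv x ν α * Φ.inv x μ β *
        (pd α (fun y => Φ.flat ξ y β) x - pd β (fun y => Φ.flat ξ y α) x)
      + 2 * (ξ x ν * Φ.grad x Φ.coupling μ - ξ x μ * Φ.grad x Φ.coupling ν))

/-- The charge form of covariant phase space, `𝒌_ξ(δΦ; Φ) = δ𝑸_ξ - ξ · 𝜣(δΦ, Φ)`, as the
bivector density `√(-g) k^{μν}` for which the symplectic current is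
`√(-g) ω^μ = ∂_ν (√(-g) k^{μν})` on shell. The variation `δ` of the Noether potential is the
directional derivative along `δΦ`, and it does not act on `ξ`. -/
def chargeDensity (G : ℝ) (ξ : Point → Fin 4 → ℝ) (μ ν : Fin 4) : ℝ :=
  deriv (fun s => (Φ.perturb δΦ s).vol x * (Φ.perturb δΦ s).noetherPotential x G ξ μ ν) 0
    + Φ.vol x * (ξ x μ * Φ.theta δΦ x G ν - ξ x ν * Φ.theta δΦ x G μ)

/-- Lie derivative of the metric along `ξ`. -/
def lieMetric (ξ : Point → Fin 4 → ℝ) (μ ν : Fin 4) : ℝ :=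
  ∑ l, (ξ x l * pd l (fun y => Φ.metric y μ ν) x + Φ.metric x l ν * pd μ (fun y => ξ y l) x
    + Φ.metric x μ l * pd ν (fun y => ξ y l) x)

/-- Lie derivative of the dilaton along `ξ`. -/
def lieDilaton (ξ : Point → Fin 4 → ℝ) : ℝ := ∑ l, ξ x l * pd l Φ.dilaton x

/-- `ξ` generates an exact symmetry of the fields on `D`: `δ_ξ Φ = 0`. -/
def IsExactSymmetry (ξ : Point → Fin 4 → ℝ) (D : Set Point) : Prop :=
  ∀ x ∈ D, (∀ μ ν, Φ.lieMetric x ξ μ ν = 0) ∧ Φ.lieDilaton x ξ = 0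

end Fields

/-- Range of the angles `(θ, ϕ)` on a coordinate sphere, up to a null set. -/
def angles : Set (ℝ × ℝ) := Ioo 0 Real.pi ×ˢ Ioo 0 (2 * Real.pi)

/-- The `dθ dϕ` component of `𝒌_ξ(δΦ; Φ)` on the sphere of constant `t` and `r`
(coordinates `(t, r, θ, ϕ)`, outward orientation), which is `√(-g) k^{tr}`. -/
def sphereIntegrand (G : ℝ) (Φ δΦ : Fields) (ξ : Point → Fin 4 → ℝ) (t r : ℝ) (q : ℝ × ℝ) : ℝ :=
  Φ.chargeDensity δΦ ![t, r, q.1, q.2] G ξ 0 1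

/-- The charge variation `δH_ξ = ∮ 𝒌_ξ(δΦ; Φ)` over the sphere of constant `t` and `r`. -/
def chargeVariation (G : ℝ) (Φ δΦ : Fields) (ξ : Point → Fin 4 → ℝ) (t r : ℝ) : ℝ :=
  ∫ q in angles, sphereIntegrand G Φ δΦ ξ t r q

/-! ### The Kerr family -/

/-- Solution parameters `p = (m, a, φ_∞)`. -/
abbrev Params := Fin 3 → ℝ

/-- The (non-extremal) black hole range of the parameters. -/
def blackHoles : Set Params := {p | |p 1| < p 0}

/-- The Kerr metric in Boyer-Lindquist coordinates `(t, r, θ, ϕ)`. -/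
def kerrMetric (p : Params) (x : Point) : Matrix (Fin 4) (Fin 4) ℝ :=
  let m := p 0
  let a := p 1
  let r := x 1
  let s := Real.sin (x 2)
  let ρ2 := r ^ 2 + a ^ 2 * Real.cos (x 2) ^ 2
  let Δ := r ^ 2 + a ^ 2 - 2 * m * r
  let f := 2 * m * r / ρ2
  !![-(1 - f), 0, 0, -(f * a * s ^ 2);
     0, ρ2 / Δ, 0, 0;
     0, 0, ρ2, 0;
     -(f * a * s ^ 2), 0, 0, (r ^ 2 + a ^ 2 + f * a ^ 2 * s ^ 2) * s ^ 2]

/-- The Kerr solution with constant dilaton `φ = φ_∞`. -/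
def kerr (p : Params) : Fields where
  metric := kerrMetric p
  dilaton _ := p 2

/-- The parametric variation `∑ᵢ (∂Φ/∂pᵢ) δpᵢ` of the Kerr fields. -/
def kerrVariation (p δp : Params) : Fields where
  metric x := Matrix.of fun μ ν => ∑ i, pd i (fun q => (kerr q).metric x μ ν) p * δp i
  dilaton x := ∑ i, pd i (fun q => (kerr q).dilaton x) p * δp i

/-- `r_H = m + √(m² - a²)`. -/
def horizonRadius (p : Params) : ℝ := p 0 + Real.sqrt (p 0 ^ 2 - p 1 ^ 2)

/-- The region outside the horizon (off the rotation axis, where the coordinates degenerate). -/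
def exterior (p : Params) : Set Point := {x | horizonRadius p < x 1 ∧ x 2 ∈ Ioo 0 Real.pi}

/-- `Ω_H = a / (2 m r_H)`. -/
def angularVelocityH (p : Params) : ℝ := p 1 / (2 * p 0 * horizonRadius p)

/-- `Ω_∞ = 0`. -/
def angularVelocityInfty (_p : Params) : ℝ := 0

/-- `κ_H = √(m² - a²) / (2 m r_H)`. -/
def surfaceGravity (p : Params) : ℝ :=
  Real.sqrt (p 0 ^ 2 - p 1 ^ 2) / (2 * p 0 * horizonRadius p)

/-- Hawking temperature `T_H = κ_H / 2π`. -/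
def temperature (p : Params) : ℝ := surfaceGravity p / (2 * Real.pi)

/-- The constant vector field `u ∂_t + w ∂_ϕ`. -/
def stationaryAxial (u w : ℝ) (_x : Point) : Fin 4 → ℝ := ![u, 0, 0, w]

/-- The frame dragging velocity `- g_{tϕ} / g_{ϕϕ}` tends to `Ω` as `r` tends along `l`. -/
def HasAngularVelocity (p : Params) (l : Filter ℝ) (Ω : ℝ) : Prop :=
  ∀ t ϕ : ℝ, ∀ θ ∈ Ioo 0 Real.pi,
    Tendsto (fun r => -(kerrMetric p ![t, r, θ, ϕ] 0 3) / kerrMetric p ![t, r, θ, ϕ] 3 3) l (𝓝 Ω)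

/-- Squared norm `ξ_μ ξ^μ` of a vector field in the Kerr metric. -/
def normSq (p : Params) (ξ : Point → Fin 4 → ℝ) (x : Point) : ℝ :=
  ∑ μ, ∑ ν, kerrMetric p x μ ν * ξ x μ * ξ x ν

/-- `ξ` becomes null at `r = r_H` and has surface gravity `κ ≥ 0` there: with `N = ξ_μ ξ^μ`,
`N → 0` and `κ² = lim (- ∂_μ N ∂^μ N / (4 N))`, i.e. `κ` is the limit of the norm of the
gradient of the redshift factor `√(-N)`. -/
def HasHorizonSurfaceGravity (p : Params) (ξ : Point → Fin 4 → ℝ) (κ : ℝ) : Prop :=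
  0 ≤ κ ∧ ∀ t ϕ : ℝ, ∀ θ ∈ Ioo 0 Real.pi,
    Tendsto (fun r => normSq p ξ ![t, r, θ, ϕ]) (𝓝[>] horizonRadius p) (𝓝 0) ∧
    (∀ᶠ r in 𝓝[>] horizonRadius p, normSq p ξ ![t, r, θ, ϕ] < 0) ∧
    Tendsto (fun r => -(∑ μ, pd μ (normSq p ξ) ![t, r, θ, ϕ] *
        (kerr p).grad ![t, r, θ, ϕ] (normSq p ξ) μ) / (4 * normSq p ξ ![t, r, θ, ϕ]))
      (𝓝[>] horizonRadius p) (𝓝 (κ ^ 2))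

/-- Area of the horizon cross section `r = r_H`, `t` constant. -/
def horizonArea (p : Params) : ℝ :=
  ∫ q in angles, Real.sqrt
    (kerrMetric p ![0, horizonRadius p, q.1, q.2] 2 2 *
        kerrMetric p ![0, horizonRadius p, q.1, q.2] 3 3
      - kerrMetric p ![0, horizonRadius p, q.1, q.2] 2 3 ^ 2)

/-- Generator of the mass, `∂_t + Ω_∞ ∂_ϕ`. -/
def genM (p : Params) : Point → Fin 4 → ℝ := stationaryAxial 1 (angularVelocityInfty p)

/-- Generator of the angular momentum, `-∂_ϕ`. -/
def genJ (_p : Params) : Point → Fin 4 → ℝ := stationaryAxial 0 (-1)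

/-- Generator of the entropy, `(2π / κ_H) (∂_t + Ω_H ∂_ϕ)`. -/
def genS (p : Params) : Point → Fin 4 → ℝ :=
  stationaryAxial (2 * Real.pi / surfaceGravity p)
    (2 * Real.pi / surfaceGravity p * angularVelocityH p)

/-- Parametric charge variation of the Kerr family for the generators `η p`, as a one-form on the
parameter space; at `p` it is computed on the sphere `t = T p`, `r = R p`. -/
def paramCharge (G : ℝ) (η : Params → Point → Fin 4 → ℝ) (T R : Params → ℝ) (p δp : Params) : ℝ :=
  chargeVariation G (kerr p) (kerrVariation p δp) (η p) (T p) (R p)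

/-- The parametric variation of the mass. -/
def massVariation (G : ℝ) (T R : Params → ℝ) : Params → Params → ℝ := paramCharge G genM T R

/-- The parametric variation of the angular momentum. -/
def angularMomentumVariation (G : ℝ) (T R : Params → ℝ) : Params → Params → ℝ :=
  paramCharge G genJ T R

/-- The parametric variation of the entropy of the horizon. -/
def entropyVariation (G : ℝ) (T R : Params → ℝ) : Params → Params → ℝ := paramCharge G genS T R

/-- The charge variations that occur in the first law. -/
def firstLawVariations (G : ℝ) (T R : Params → ℝ) : Fin 3 → Params → Params → ℝ :=
  ![massVariation G T R, angularMomentumVariation G T R, entropyVariation G T R]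

/-- The integrand of `paramCharge` is integrable over the sphere. -/
def ParamChargeConverges (G : ℝ) (η : Params → Point → Fin 4 → ℝ) (T R : Params → ℝ)
    (p δp : Params) : Prop :=
  IntegrableOn (sphereIntegrand G (kerr p) (kerrVariation p δp) (η p) (T p) (R p)) angles

/-! ### Integrability of charge variations -/

/-- The one-form `F` on parameter space has potential `H` at every `p ∈ U` as far as variations
`δp ∈ V` are concerned (the other variations being put to zero). -/
def IsPotentialAlong (F : Params → Params → ℝ) (V : Submodule ℝ Params) (U : Set Params)
    (H : Params → ℝ) : Prop :=
  ∀ p ∈ U, ∃ L : V →L[ℝ] ℝ, (∀ v : V, L v = F p v) ∧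
    HasFDerivAt (fun v : V => H (p + v)) L 0

/-- The charge variation `F` is integrable on `U` for variations in `V`. -/
def IntegrableAlong (F : Params → Params → ℝ) (V : Submodule ℝ Params) (U : Set Params) : Prop :=
  ∃ H : Params → ℝ, IsPotentialAlong F V U H

/-- The variations of the parameters in `P`, the other parameters being held fixed. -/
def variationsOf (P : Set (Fin 3)) : Submodule ℝ Params := Submodule.pi Pᶜ fun _ => ⊥

/-- The variations of `m` and `a`, with `δφ_∞ = 0`. -/
def fixedModulus : Submodule ℝ Params := variationsOf {0, 1}

/-- First necessary condition for the parameter `i` to be physical: all the charge variations `C`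
in the first law are integrable when `i` is varied, along with the parameters in `P`. -/
def IntegrabilityCondition (C : Fin 3 → Params → Params → ℝ) (P : Set (Fin 3)) (i : Fin 3) : Prop :=
  ∀ k, IntegrableAlong (C k) (variationsOf (insert i P)) blackHoles

/-- Second necessary condition for the parameter `i` to be physical: some integrable charge
variation has a non-zero contribution from `i`. -/
def ContributionCondition (C : Fin 3 → Params → Params → ℝ) (P : Set (Fin 3)) (i : Fin 3) : Prop :=
  ∃ k, IntegrableAlong (C k) (variationsOf (insert i P)) blackHoles ∧
    ∀ p ∈ blackHoles, C k p (Pi.single i 1) ≠ 0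

/-- `H` is the finite charge obtained by integrating `F` over black holes at fixed `φ_∞`, with the
flat spacetime `m, a → 0` as reference point of zero charge. -/
def IsFiniteCharge (F : Params → Params → ℝ) (H : Params → ℝ) : Prop :=
  IsPotentialAlong F fixedModulus blackHoles H ∧
    ∀ c : ℝ, Tendsto (fun q : ℝ × ℝ => H ![q.1, q.2, c]) (𝓝[{q | |q.2| < q.1}] 0) (𝓝 0)

/-- `M = m e^{-φ_∞} / G`. -/
def massCharge (G : ℝ) (p : Params) : ℝ := p 0 * Real.exp (-p 2) / G

/-- `J = m a e^{-φ_∞} / G`. -/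
def angularMomentum (G : ℝ) (p : Params) : ℝ := p 0 * p 1 * Real.exp (-p 2) / G

/-- `S_H = A_H e^{-φ_∞} / (4 G)`. -/
def entropy (G : ℝ) (p : Params) : ℝ := horizonArea p * Real.exp (-p 2) / (4 * G)

end EinsteinDilaton

end

open EinsteinDilaton

noncomputable section

namespace EinsteinDilaton

/-! ### Partial derivatives of fields that depend on `r` and `θ` only -/

/-! The dilaton is constant, so the field equations reduce to Ricci flatness of Kerr. The connection
is known in closed form (`kerrGamma_eq`) and depends on r and θ only. Its trace is the gradient of
log √(-g) with √(-g) = ρ² sin θ, hence R_{μν} only involves ∂_r Γ^r, ∂_θ Γ^θ, the Hessian of log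
√(-g) and quadratic terms, whose sum vanishes identically (`kerrGamma_ricci`, `ricci_kerr`).

The charges come from one formula, linear in the generator u ∂_t + w ∂_ϕ (`chargeVariation_kerr`).
The density √(-g) k^{tr} is the variation of the Komar density plus u √(-g) Θ^r, since the generator
has no r component (`chargeDensity_kerr`). Each piece has an explicit antiderivative in θ. At the
poles ρ² = r² + a², so the radius drops out of the integral (`integral_chargeProfile`).

The obstruction is visible in this split. The Komar integral of ∂_t yields only half of the mass and
Θ supplies the other half of δm. But δφ_∞ acts only on the factor e^{-φ} of the Komar term, which
gives δM = e^{-φ_∞}(δm - (m/2) δφ_∞)/G. The exterior derivative of this form is e^{-φ_∞} dm ∧ dφ_∞ /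
(2G), which never vanishes, and symmetry of second derivatives forces δφ_∞ = 0 once m varies
(`modulus_eq_zero_of_integrable`). For ∂_ϕ there is no Θ term, and the variation of J is the
differential of m a e^{-φ_∞}/G.

The entropy generator is 2π/κ_H times a combination of the other two, so the first law is linearity
in the generator. That the result is the differential of e^{-φ_∞} A_H/(4G) is the algebraic identity
`entropy_form`, based on r_H² + a² = 2 m r_H.

The finite charges at fixed φ_∞ are unique because the wedge |a| < m is connected and has the origin
in its closure (`IsFiniteCharge.eqOn`). -/

lemma pd_congr {n : ℕ} {U : Set (Fin n → ℝ)} (hU : IsOpen U) {f g : (Fin n → ℝ) → ℝ}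
    (hfg : EqOn f g U) {x : Fin n → ℝ} (hx : x ∈ U) (i : Fin n) : pd i f x = pd i g x := by
  have hc : Continuous fun s : ℝ => Function.update x i s := continuous_const.update i continuous_id
  -- A small move of one coordinate stays in `U`, so the two slices have the same germ. This is what
  -- permits differentiating closed forms known only in the exterior.
  have hU' : ∀ᶠ s in 𝓝 (x i), Function.update x i s ∈ U :=
    hc.continuousAt.eventually_mem (hU.mem_nhds (by simpa using hx))
  exact Filter.EventuallyEq.deriv_eq (hU'.mono fun s hs => hfg hs)

@[simp] lemma pd_const {n : ℕ} (i : Fin n) (k : ℝ) (x : Fin n → ℝ) : pd i (fun _ => k) x = 0 := by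
  simp [pd]

lemma pd_t (F : ℝ → ℝ → ℝ) (x : Point) : pd 0 (fun y => F (y 1) (y 2)) x = 0 := by simp [pd]

lemma pd_phi (F : ℝ → ℝ → ℝ) (x : Point) : pd 3 (fun y => F (y 1) (y 2)) x = 0 := by simp [pd]

lemma pd_r {F : ℝ → ℝ → ℝ} {x : Point} {d : ℝ} (h : HasDerivAt (fun r => F r (x 2)) d (x 1)) :
    pd 1 (fun y => F (y 1) (y 2)) x = d := by
  simpa [pd] using h.deriv

lemma pd_theta {F : ℝ → ℝ → ℝ} {x : Point} {d : ℝ} (h : HasDerivAt (fun θ => F (x 1) θ) d (x 2)) :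
    pd 2 (fun y => F (y 1) (y 2)) x = d := by
  simpa [pd] using h.deriv

/-! ### The Kerr metric: components, derivatives, inverse -/

/-- `ρ² = r² + a² cos² θ`. -/
def rhoSq (a r θ : ℝ) : ℝ := r ^ 2 + a ^ 2 * Real.cos θ ^ 2

/-- `Δ = r² + a² - 2 m r`. -/
def horizonPoly (m a r : ℝ) : ℝ := r ^ 2 + a ^ 2 - 2 * m * r

lemma hasDerivAt_rhoSq_r (a r θ : ℝ) : HasDerivAt (fun r => rhoSq a r θ) (2 * r) r := by
  simpa [rhoSq] using ((hasDerivAt_id r).pow 2).add_const (a ^ 2 * Real.cos θ ^ 2)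

lemma hasDerivAt_rhoSq_theta (a r θ : ℝ) :
    HasDerivAt (fun θ => rhoSq a r θ) (-(2 * a ^ 2 * Real.cos θ * Real.sin θ)) θ := by
  have := (((Real.hasDerivAt_cos θ).pow 2).const_mul (a ^ 2)).const_add (r ^ 2)
  refine this.congr_deriv ?_
  simp; ring

lemma hasDerivAt_rhoSq_a (a r θ : ℝ) :
    HasDerivAt (fun a => rhoSq a r θ) (2 * a * Real.cos θ ^ 2) a := by
  have := (((hasDerivAt_id a).pow 2).mul_const (Real.cos θ ^ 2)).const_add (r ^ 2)
  refine this.congr_deriv ?_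
  simp

lemma hasDerivAt_horizonPoly_r (m a r : ℝ) :
    HasDerivAt (fun r => horizonPoly m a r) (2 * r - 2 * m) r := by
  have := (((hasDerivAt_id r).pow 2).add_const (a ^ 2)).sub ((hasDerivAt_id r).const_mul (2 * m))
  refine this.congr_deriv ?_
  simp

lemma hasDerivAt_horizonPoly_m (m a r : ℝ) :
    HasDerivAt (fun m => horizonPoly m a r) (-(2 * r)) m := by
  have := (((hasDerivAt_id m).const_mul 2).mul_const r).const_sub (r ^ 2 + a ^ 2)
  refine this.congr_deriv ?_
  simp

lemma hasDerivAt_horizonPoly_a (m a r : ℝ) :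
    HasDerivAt (fun a => horizonPoly m a r) (2 * a) a := by
  have := (((hasDerivAt_id a).pow 2).const_add (r ^ 2)).sub_const (2 * m * r)
  refine this.congr_deriv ?_
  simp

/-- `g_{tt}`. -/
def gtt (m a r θ : ℝ) : ℝ := -(1 - 2 * m * r / rhoSq a r θ)

/-- `g_{tϕ}`. -/
def gtp (m a r θ : ℝ) : ℝ := -(2 * m * r / rhoSq a r θ * a * Real.sin θ ^ 2)

/-- `g_{ϕϕ}`. -/
def gpp (m a r θ : ℝ) : ℝ :=
  (r ^ 2 + a ^ 2 + 2 * m * r / rhoSq a r θ * a ^ 2 * Real.sin θ ^ 2) * Real.sin θ ^ 2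

/-- `g_{rr}`. -/
def grr (m a r θ : ℝ) : ℝ := rhoSq a r θ / horizonPoly m a r

/-- Matrices with the block structure of a stationary axisymmetric circular metric. -/
def circular (A B C D E : ℝ) : Matrix (Fin 4) (Fin 4) ℝ :=
  !![A, 0, 0, B; 0, D, 0, 0; 0, 0, E, 0; B, 0, 0, C]

lemma kerrMetric_eq (p : Params) (x : Point) :
    kerrMetric p x = circular (gtt (p 0) (p 1) (x 1) (x 2)) (gtp (p 0) (p 1) (x 1) (x 2))
      (gpp (p 0) (p 1) (x 1) (x 2)) (grr (p 0) (p 1) (x 1) (x 2)) (rhoSq (p 1) (x 1) (x 2)) := rfl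

lemma det_circular (A B C D E : ℝ) : (circular A B C D E).det = D * E * (A * C - B ^ 2) := by
  simp [circular, Matrix.det_succ_row_zero, Fin.sum_univ_succ, Fin.succAbove]
  ring

lemma inv_circular {A B C D E : ℝ} (hD : D ≠ 0) (hE : E ≠ 0) (hX : A * C - B ^ 2 ≠ 0) :
    (circular A B C D E)⁻¹ = circular (C / (A * C - B ^ 2)) (-B / (A * C - B ^ 2))
      (A / (A * C - B ^ 2)) D⁻¹ E⁻¹ := by
  apply Matrix.inv_eq_right_inv
  ext i j
  fin_cases i <;> fin_cases j <;> simp [circular, Matrix.mul_apply, Fin.sum_univ_four, hD, hE] <;>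
    field_simp <;> ring

/-! ### Signs of Δ and ρ² outside the horizon -/

section Region

variable {p : Params} {x : Point}

lemma mass_pos (hp : p ∈ blackHoles) : 0 < p 0 := (abs_nonneg _).trans_lt hp

lemma sq_lt_sq_of_blackHole (hp : p ∈ blackHoles) : p 1 ^ 2 < p 0 ^ 2 :=
  sq_lt_sq.2 (by rw [abs_of_pos (mass_pos hp)]; exact hp)

lemma sqrt_pos_of_blackHole (hp : p ∈ blackHoles) : 0 < Real.sqrt (p 0 ^ 2 - p 1 ^ 2) :=
  Real.sqrt_pos.2 (sub_pos.2 (sq_lt_sq_of_blackHole hp))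

lemma horizonRadius_pos (hp : p ∈ blackHoles) : 0 < horizonRadius p :=
  add_pos (mass_pos hp) (sqrt_pos_of_blackHole hp)

/-- The roots of Δ are m ± √(m² - a²). The factored form gives Δ > 0 beyond r_H, and exhibits the
simple zero at r_H from which κ_H arises. -/
lemma horizonPoly_factor (hp : p ∈ blackHoles) (r : ℝ) :
    horizonPoly (p 0) (p 1) r
      = (r - horizonRadius p) * (r - horizonRadius p + 2 * Real.sqrt (p 0 ^ 2 - p 1 ^ 2)) := by
  have h := Real.sq_sqrt (sub_pos.2 (sq_lt_sq_of_blackHole hp)).le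
  unfold horizonPoly horizonRadius
  linear_combination h

lemma horizonPoly_pos (hp : p ∈ blackHoles) {r : ℝ} (hr : horizonRadius p < r) :
    0 < horizonPoly (p 0) (p 1) r := by
  rw [horizonPoly_factor hp]
  have := sqrt_pos_of_blackHole hp
  exact mul_pos (sub_pos.2 hr) (by linarith)

lemma rhoSq_pos (a : ℝ) {r : ℝ} (hr : 0 < r) (θ : ℝ) : 0 < rhoSq a r θ := by
  unfold rhoSq; positivity

lemma isOpen_exterior (p : Params) : IsOpen (exterior p) := by
  have h1 : IsOpen {x : Point | horizonRadius p < x 1} :=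
    isOpen_lt continuous_const (continuous_apply 1)
  exact h1.inter (isOpen_Ioo.preimage (continuous_apply (2 : Fin 4)))

lemma isOpen_blackHoles : IsOpen blackHoles :=
  isOpen_lt (continuous_apply (1 : Fin 3)).abs (continuous_apply 0)

end Region

/-- The determinant of the `(t, ϕ)` block is `-Δ sin² θ`. -/
lemma gtt_mul_gpp_sub (m a : ℝ) {r θ : ℝ} (h : rhoSq a r θ ≠ 0) :
    gtt m a r θ * gpp m a r θ - gtp m a r θ ^ 2 = -(horizonPoly m a r * Real.sin θ ^ 2) := by
  have hS : rhoSq a r θ = r ^ 2 + a ^ 2 * Real.cos θ ^ 2 := rfl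
  unfold gtt gpp gtp horizonPoly
  field_simp
  rw [hS, Real.cos_sq']
  ring

/-- `∂_r g_{μν}`. -/
def kerrMetricDr (m a r θ : ℝ) : Matrix (Fin 4) (Fin 4) ℝ :=
  circular (-(2 * m * (r ^ 2 - a ^ 2 * Real.cos θ ^ 2)) / rhoSq a r θ ^ 2)
    (2 * m * a * Real.sin θ ^ 2 * (r ^ 2 - a ^ 2 * Real.cos θ ^ 2) / rhoSq a r θ ^ 2)
    (2 * Real.sin θ ^ 2 * (r - m * a ^ 2 * Real.sin θ ^ 2 * (r ^ 2 - a ^ 2 * Real.cos θ ^ 2)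
      / rhoSq a r θ ^ 2))
    (2 * r / horizonPoly m a r - rhoSq a r θ * (2 * r - 2 * m) / horizonPoly m a r ^ 2)
    (2 * r)

/-- `∂_θ g_{μν}`. -/
def kerrMetricDtheta (m a r θ : ℝ) : Matrix (Fin 4) (Fin 4) ℝ :=
  circular (4 * m * r * a ^ 2 * Real.cos θ * Real.sin θ / rhoSq a r θ ^ 2)
    (-(4 * m * r * a * Real.cos θ * Real.sin θ * (rhoSq a r θ + a ^ 2 * Real.sin θ ^ 2))
      / rhoSq a r θ ^ 2)
    (2 * Real.sin θ * Real.cos θ * (r ^ 2 + a ^ 2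
      + 2 * m * r * a ^ 2 * Real.sin θ ^ 2 * (2 * rhoSq a r θ + a ^ 2 * Real.sin θ ^ 2)
        / rhoSq a r θ ^ 2))
    (-(2 * a ^ 2 * Real.cos θ * Real.sin θ) / horizonPoly m a r)
    (-(2 * a ^ 2 * Real.cos θ * Real.sin θ))

section Deriv

variable {m a r θ : ℝ}

lemma hasDerivAt_metric_r (hS : rhoSq a r θ ≠ 0) (hD : horizonPoly m a r ≠ 0) (μ ν : Fin 4) :
    HasDerivAt (fun r => circular (gtt m a r θ) (gtp m a r θ) (gpp m a r θ) (grr m a r θ)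
      (rhoSq a r θ) μ ν) (kerrMetricDr m a r θ μ ν) r := by
  have e : rhoSq a r θ = r ^ 2 + a ^ 2 * Real.cos θ ^ 2 := rfl
  fin_cases μ <;> fin_cases ν <;>
    simp only [circular, kerrMetricDr, Matrix.of_apply, Matrix.cons_val', Matrix.cons_val,
      Fin.reduceFinMk, Fin.zero_eta, Fin.mk_one, Fin.isValue, gtt, gtp, gpp, grr,
      Matrix.cons_val_zero, Matrix.cons_val_one] <;>
    -- The calculus rules assemble a derivative from the shape of the entry, with ρ² and Δ kept
    -- opaque so that their own derivative lemmas apply. The result is then compared with the closed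
    -- form as a rational function.
    refine HasDerivAt.congr_deriv (by
      repeat' with_reducible first
        | exact hS
        | exact hD
        | exact hasDerivAt_const _ _
        | exact hasDerivAt_rhoSq_r _ _ _
        | exact hasDerivAt_horizonPoly_r _ _ _
        | exact hasDerivAt_id' _
        | apply HasDerivAt.fun_neg
        | apply HasDerivAt.fun_sub
        | apply HasDerivAt.fun_add
        | apply HasDerivAt.fun_div
        | apply HasDerivAt.fun_pow
        | apply HasDerivAt.fun_mul) ?_ <;> field_simp <;> (try rw [e]) <;> ring

lemma hasDerivAt_metric_theta (hS : rhoSq a r θ ≠ 0) (hD : horizonPoly m a r ≠ 0) (μ ν : Fin 4) :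
    HasDerivAt (fun θ => circular (gtt m a r θ) (gtp m a r θ) (gpp m a r θ) (grr m a r θ)
      (rhoSq a r θ) μ ν) (kerrMetricDtheta m a r θ μ ν) θ := by
  fin_cases μ <;> fin_cases ν <;>
    simp only [circular, kerrMetricDtheta, Matrix.of_apply, Matrix.cons_val', Matrix.cons_val,
      Fin.reduceFinMk, Fin.zero_eta, Fin.mk_one, Fin.isValue, gtt, gtp, gpp, grr,
      Matrix.cons_val_zero, Matrix.cons_val_one] <;>
    refine HasDerivAt.congr_deriv (by
      repeat' with_reducible first
        | exact hS
        | exact hD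
        | exact hasDerivAt_const _ _
        | exact hasDerivAt_rhoSq_theta _ _ _
        | exact Real.hasDerivAt_sin _
        | apply HasDerivAt.fun_neg
        | apply HasDerivAt.fun_sub
        | apply HasDerivAt.fun_add
        | apply HasDerivAt.fun_div
        | apply HasDerivAt.fun_pow
        | apply HasDerivAt.fun_mul) ?_ <;> field_simp <;> ring

end Deriv

/-- The inverse metric `g^{μν}`. -/
def kerrInverse (m a r θ : ℝ) : Matrix (Fin 4) (Fin 4) ℝ :=
  circular (-(r ^ 2 + a ^ 2 + 2 * m * r / rhoSq a r θ * a ^ 2 * Real.sin θ ^ 2) / horizonPoly m a r)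
    (-(2 * m * r * a) / (rhoSq a r θ * horizonPoly m a r))
    ((rhoSq a r θ - 2 * m * r) / (rhoSq a r θ * horizonPoly m a r * Real.sin θ ^ 2))
    (horizonPoly m a r / rhoSq a r θ) (1 / rhoSq a r θ)

/-- `∂_l g_{μν}`. -/
def kerrMetricDeriv (m a r θ : ℝ) : Fin 4 → Matrix (Fin 4) (Fin 4) ℝ :=
  ![0, kerrMetricDr m a r θ, kerrMetricDtheta m a r θ, 0]

/-- The Christoffel symbols `Γ^l_{μν}` of the Kerr metric. -/
def kerrGamma (m a r θ : ℝ) : Fin 4 → Matrix (Fin 4) (Fin 4) ℝ :=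
  let s := Real.sin θ
  let c := Real.cos θ
  let S := rhoSq a r θ
  let D := horizonPoly m a r
  let q := r ^ 2 - a ^ 2 * c ^ 2
  let ttr := m * (r ^ 2 + a ^ 2) * q / (S ^ 2 * D)
  let ttθ := -(2 * m * a ^ 2 * r * s * c) / S ^ 2
  let trϕ := m * a * s ^ 2 * (a ^ 2 * c ^ 2 * (a ^ 2 - r ^ 2) - r ^ 2 * (a ^ 2 + 3 * r ^ 2))
    / (S ^ 2 * D)
  let tθϕ := 2 * m * a ^ 3 * r * s ^ 3 * c / S ^ 2
  let rtϕ := -(D * m * a * s ^ 2 * q) / S ^ 3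
  let rrθ := -(a ^ 2 * s * c) / S
  let θtϕ := 2 * m * a * r * (r ^ 2 + a ^ 2) * s * c / S ^ 3
  let θrθ := r / S
  let ϕtr := m * a * q / (S ^ 2 * D)
  let ϕtθ := -(2 * m * a * r * c) / (S ^ 2 * s)
  let ϕrϕ := (r * S ^ 2 + m * (a ^ 4 * s ^ 2 * c ^ 2 - r ^ 2 * (S + r ^ 2 + a ^ 2))) / (S ^ 2 * D)
  let ϕθϕ := c * (S ^ 2 + 2 * m * a ^ 2 * r * s ^ 2) / (s * S ^ 2)
  ![!![0, ttr, ttθ, 0; ttr, 0, 0, trϕ; ttθ, 0, 0, tθϕ; 0, trϕ, tθϕ, 0],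
    !![m * D * q / S ^ 3, 0, 0, rtϕ;
       0, (r * a ^ 2 * s ^ 2 - m * q) / (S * D), rrθ, 0;
       0, rrθ, -(r * D) / S, 0;
       rtϕ, 0, 0, D * s ^ 2 * (m * a ^ 2 * s ^ 2 * q - r * S ^ 2) / S ^ 3],
    !![-(2 * m * a ^ 2 * r * s * c) / S ^ 3, 0, 0, θtϕ;
       0, a ^ 2 * s * c / (S * D), θrθ, 0;
       0, θrθ, -(a ^ 2 * s * c) / S, 0;
       θtϕ, 0, 0, -(s * c * ((r ^ 2 + a ^ 2) * S ^ 2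
         + 2 * m * r * a ^ 2 * s ^ 2 * (2 * S + a ^ 2 * s ^ 2))) / S ^ 3],
    !![0, ϕtr, ϕtθ, 0; ϕtr, 0, 0, ϕrϕ; ϕtθ, 0, 0, ϕθϕ; 0, ϕrϕ, ϕθϕ, 0]]

/-- The Levi-Civita formula, one component at a time. With ρ², Δ and the even powers of sine
expressed through r, m, a and cos θ, each component is a polynomial identity. -/
lemma kerrGamma_eq {m a r θ : ℝ} (hS : rhoSq a r θ ≠ 0) (hD : horizonPoly m a r ≠ 0)
    (hs : Real.sin θ ≠ 0) (l μ ν : Fin 4) :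
    (1 / 2) * ∑ σ, kerrInverse m a r θ l σ * (kerrMetricDeriv m a r θ μ σ ν
      + kerrMetricDeriv m a r θ ν σ μ - kerrMetricDeriv m a r θ σ μ ν)
      = kerrGamma m a r θ l μ ν := by
  have eS : rhoSq a r θ = r ^ 2 + a ^ 2 * Real.cos θ ^ 2 := rfl
  have eD : horizonPoly m a r = r ^ 2 + a ^ 2 - 2 * m * r := rfl
  have h2 := Real.sin_sq θ
  have h4 : Real.sin θ ^ 4 = (1 - Real.cos θ ^ 2) ^ 2 := by rw [← h2]; ring
  fin_cases l <;> fin_cases μ <;> fin_cases ν <;>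
    simp only [circular, kerrMetricDr, kerrMetricDtheta, kerrMetricDeriv, kerrInverse, kerrGamma,
      Matrix.of_apply, Matrix.cons_val', Matrix.cons_val, Fin.sum_univ_four, Matrix.zero_apply,
      Fin.reduceFinMk, Fin.zero_eta, Fin.mk_one, Fin.isValue, mul_zero, zero_mul, add_zero,
      zero_add, sub_zero, zero_sub, sub_self, mul_neg, neg_zero] <;> try (
      field_simp
      try rw [eS, eD]
      try rw [eS]
      first
        | done
        | ring1
        | (ring_nf; simp only [h2, h4]; ring1))

/-! ### The Kerr fields in terms of the closed forms -/

section Exterior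

variable {p : Params} {x : Point}

lemma exterior_pos (hp : p ∈ blackHoles) (hx : x ∈ exterior p) :
    0 < rhoSq (p 1) (x 1) (x 2) ∧ 0 < horizonPoly (p 0) (p 1) (x 1) ∧ 0 < Real.sin (x 2) :=
  ⟨rhoSq_pos _ ((horizonRadius_pos hp).trans hx.1) _, horizonPoly_pos hp hx.1,
    Real.sin_pos_of_mem_Ioo hx.2⟩

lemma kerr_inv (hp : p ∈ blackHoles) (hx : x ∈ exterior p) :
    (kerr p).inv x = kerrInverse (p 0) (p 1) (x 1) (x 2) := by
  obtain ⟨hS, hD, hs⟩ := exterior_pos hp hx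
  have hX := gtt_mul_gpp_sub (p 0) (p 1) hS.ne'
  have hX0 : -(horizonPoly (p 0) (p 1) (x 1) * Real.sin (x 2) ^ 2) ≠ 0 := by
    have : 0 < horizonPoly (p 0) (p 1) (x 1) * Real.sin (x 2) ^ 2 := by positivity
    linarith
  change (kerrMetric p x)⁻¹ = _
  have hrr : grr (p 0) (p 1) (x 1) (x 2) ≠ 0 := (div_pos hS hD).ne'
  rw [kerrMetric_eq, inv_circular hrr hS.ne' (by rw [hX]; exact hX0), hX]
  have hS := hS.ne'
  have hD := hD.ne'
  have hs := hs.ne'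
  unfold kerrInverse gtt gtp gpp grr
  congr 1 <;> field_simp

lemma pd_kerrMetric (hp : p ∈ blackHoles) (hx : x ∈ exterior p) (l μ ν : Fin 4) :
    pd l (fun y => (kerr p).metric y μ ν) x
      = kerrMetricDeriv (p 0) (p 1) (x 1) (x 2) l μ ν := by
  obtain ⟨hS, hD, hs⟩ := exterior_pos hp hx
  let F : ℝ → ℝ → ℝ := fun r θ => circular (gtt (p 0) (p 1) r θ) (gtp (p 0) (p 1) r θ)
    (gpp (p 0) (p 1) r θ) (grr (p 0) (p 1) r θ) (rhoSq (p 1) r θ) μ ν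
  change pd l (fun y => F (y 1) (y 2)) x = _
  fin_cases l
  · exact pd_t F x
  · exact pd_r (hasDerivAt_metric_r hS.ne' hD.ne' μ ν)
  · exact pd_theta (hasDerivAt_metric_theta hS.ne' hD.ne' μ ν)
  · exact pd_phi F x

lemma christoffel_kerr (hp : p ∈ blackHoles) (hx : x ∈ exterior p) (l μ ν : Fin 4) :
    (kerr p).christoffel x l μ ν = kerrGamma (p 0) (p 1) (x 1) (x 2) l μ ν := by
  obtain ⟨hS, hD, hs⟩ := exterior_pos hp hx
  rw [← kerrGamma_eq hS.ne' hD.ne' hs.ne']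
  unfold Fields.christoffel
  simp only [kerr_inv hp hx, pd_kerrMetric hp hx]

end Exterior

/-! ### The Kerr metric is Ricci flat -/

/-- `∂_r Γ^r_{μν}`. -/
def kerrGammaDr (m a r θ : ℝ) : Matrix (Fin 4) (Fin 4) ℝ :=
  let s := Real.sin θ
  let c := Real.cos θ
  let S := rhoSq a r θ
  let D := horizonPoly m a r
  let q := r ^ 2 - a ^ 2 * c ^ 2
  let tt := m * ((2 * r - 2 * m) * q + 2 * r * D) / S ^ 3 - 6 * r * m * D * q / S ^ 4
  let rθ := 2 * r * a ^ 2 * s * c / S ^ 2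
  let y := m * a ^ 2 * s ^ 2 * q - r * S ^ 2
  !![tt, 0, 0, -(a * s ^ 2) * tt;
     0, (a ^ 2 * s ^ 2 - 2 * m * r) / (S * D)
       - (r * a ^ 2 * s ^ 2 - m * q) * (2 * r * D + S * (2 * r - 2 * m)) / (S * D) ^ 2, rθ, 0;
     0, rθ, -(D + r * (2 * r - 2 * m)) / S + 2 * r ^ 2 * D / S ^ 2, 0;
     -(a * s ^ 2) * tt, 0, 0, s ^ 2 * ((2 * r - 2 * m) * y
       + D * (2 * r * m * a ^ 2 * s ^ 2 - S ^ 2 - 4 * r ^ 2 * S)) / S ^ 3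
       - 6 * r * D * s ^ 2 * y / S ^ 4]

/-- `∂_θ Γ^θ_{μν}`. -/
def kerrGammaDtheta (m a r θ : ℝ) : Matrix (Fin 4) (Fin 4) ℝ :=
  let s := Real.sin θ
  let c := Real.cos θ
  let S := rhoSq a r θ
  let D := horizonPoly m a r
  let k := (c ^ 2 - s ^ 2) / S ^ 3 + 6 * a ^ 2 * c ^ 2 * s ^ 2 / S ^ 4
  let tϕ := 2 * m * a * r * (r ^ 2 + a ^ 2) * k
  let rθ := 2 * r * a ^ 2 * s * c / S ^ 2
  let l := (c ^ 2 - s ^ 2) / S + 2 * a ^ 2 * c ^ 2 * s ^ 2 / S ^ 2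
  let y := (r ^ 2 + a ^ 2) * S ^ 2 + 2 * m * r * a ^ 2 * s ^ 2 * (2 * S + a ^ 2 * s ^ 2)
  let y' := -(4 * a ^ 2 * (r ^ 2 + a ^ 2) * S * c * s)
    + 2 * m * r * a ^ 2 * (2 * s * c * (2 * S + a ^ 2 * s ^ 2) - 2 * a ^ 2 * c * s ^ 3)
  !![-(2 * m * a ^ 2 * r) * k, 0, 0, tϕ;
     0, a ^ 2 * l / D, rθ, 0;
     0, rθ, -(a ^ 2 * l), 0;
     tϕ, 0, 0, -((c ^ 2 - s ^ 2) * y + s * c * y') / S ^ 3 - 6 * a ^ 2 * s ^ 2 * c ^ 2 * y / S ^ 4]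

section Deriv

variable {m a r θ : ℝ}

/-- In the divergence ∂_l Γ^l_{μν} only l = r and l = θ survive, so Γ^r is differentiated in r alone
and Γ^θ in θ alone. -/
lemma hasDerivAt_gamma_r (hS : rhoSq a r θ ≠ 0) (hD : horizonPoly m a r ≠ 0) (μ ν : Fin 4) :
    HasDerivAt (fun r => kerrGamma m a r θ 1 μ ν) (kerrGammaDr m a r θ μ ν) r := by
  have hS3 := pow_ne_zero 3 hS
  have hSD := mul_ne_zero hS hD
  fin_cases μ <;> fin_cases ν <;>
    simp only [kerrGamma, kerrGammaDr, Matrix.of_apply, Matrix.cons_val', Matrix.cons_val,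
      Fin.reduceFinMk, Fin.zero_eta, Fin.mk_one, Fin.isValue,
      Matrix.cons_val_zero, Matrix.cons_val_one] <;>
    refine HasDerivAt.congr_deriv (by
      repeat' with_reducible first
        | exact hS
        | exact hS3
        | exact hSD
        | exact hasDerivAt_const _ _
        | exact hasDerivAt_rhoSq_r _ _ _
        | exact hasDerivAt_horizonPoly_r _ _ _
        | exact hasDerivAt_id' _
        | apply HasDerivAt.fun_neg
        | apply HasDerivAt.fun_sub
        | apply HasDerivAt.fun_add
        | apply HasDerivAt.fun_div
        | apply HasDerivAt.fun_pow
        | apply HasDerivAt.fun_mul) ?_ <;> field_simp <;> ring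

lemma hasDerivAt_gamma_theta (hS : rhoSq a r θ ≠ 0) (hD : horizonPoly m a r ≠ 0) (μ ν : Fin 4) :
    HasDerivAt (fun θ => kerrGamma m a r θ 2 μ ν) (kerrGammaDtheta m a r θ μ ν) θ := by
  have hS3 := pow_ne_zero 3 hS
  have hSD := mul_ne_zero hS hD
  fin_cases μ <;> fin_cases ν <;>
    simp only [kerrGamma, kerrGammaDtheta, Matrix.of_apply, Matrix.cons_val', Matrix.cons_val,
      Fin.reduceFinMk, Fin.zero_eta, Fin.mk_one, Fin.isValue,
      Matrix.cons_val_zero, Matrix.cons_val_one] <;>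
    refine HasDerivAt.congr_deriv (by
      repeat' with_reducible first
        | exact hS
        | exact hS3
        | exact hSD
        | exact hasDerivAt_const _ _
        | exact hasDerivAt_rhoSq_theta _ _ _
        | exact Real.hasDerivAt_sin _
        | exact Real.hasDerivAt_cos _
        | apply HasDerivAt.fun_neg
        | apply HasDerivAt.fun_sub
        | apply HasDerivAt.fun_add
        | apply HasDerivAt.fun_div
        | apply HasDerivAt.fun_pow
        | apply HasDerivAt.fun_mul) ?_ <;> field_simp <;> ring

/-- The derivatives of the single terms of the trace Γ^l_{μl} are never needed explicitly. Their
existence suffices to differentiate the sum, which is simple. -/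
lemma differentiableAt_gamma_r (hS : rhoSq a r θ ≠ 0) (hD : horizonPoly m a r ≠ 0)
    (hs : Real.sin θ ≠ 0) (l μ : Fin 4) :
    DifferentiableAt ℝ (fun r => kerrGamma m a r θ l μ l) r := by
  have d1 := (hasDerivAt_rhoSq_r a r θ).differentiableAt
  have d2 := (hasDerivAt_horizonPoly_r m a r).differentiableAt
  fin_cases l <;> fin_cases μ <;>
    simp only [kerrGamma, Matrix.of_apply, Matrix.cons_val', Matrix.cons_val,
      Fin.reduceFinMk, Fin.zero_eta, Fin.mk_one, Fin.isValue,
      Matrix.cons_val_zero, Matrix.cons_val_one] <;>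
    fun_prop (disch := simp [hS, hD, hs])

lemma differentiableAt_gamma_theta (hS : rhoSq a r θ ≠ 0) (hD : horizonPoly m a r ≠ 0)
    (hs : Real.sin θ ≠ 0) (l μ : Fin 4) :
    DifferentiableAt ℝ (fun θ => kerrGamma m a r θ l μ l) θ := by
  have d1 := (hasDerivAt_rhoSq_theta a r θ).differentiableAt
  fin_cases l <;> fin_cases μ <;>
    simp only [kerrGamma, Matrix.of_apply, Matrix.cons_val', Matrix.cons_val,
      Fin.reduceFinMk, Fin.zero_eta, Fin.mk_one, Fin.isValue,
      Matrix.cons_val_zero, Matrix.cons_val_one] <;>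
    fun_prop (disch := simp [hS, hD, hs])

end Deriv

/-- `Γ^l_{lμ} = ∂_μ log √(-g)`. -/
def kerrLogVolDeriv (a r θ : ℝ) : Fin 4 → ℝ :=
  ![0, 2 * r / rhoSq a r θ,
    Real.cos θ / Real.sin θ - 2 * a ^ 2 * Real.cos θ * Real.sin θ / rhoSq a r θ, 0]

/-- `∂_μ ∂_ν log √(-g)`. -/
def kerrLogVolHess (a r θ : ℝ) : Matrix (Fin 4) (Fin 4) ℝ :=
  let s := Real.sin θ
  let c := Real.cos θ
  let S := rhoSq a r θ
  !![0, 0, 0, 0;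
     0, 2 / S - 4 * r ^ 2 / S ^ 2, 4 * r * a ^ 2 * c * s / S ^ 2, 0;
     0, 4 * r * a ^ 2 * c * s / S ^ 2,
       -1 / s ^ 2 - 2 * a ^ 2 * ((c ^ 2 - s ^ 2) / S + 2 * a ^ 2 * c ^ 2 * s ^ 2 / S ^ 2), 0;
     0, 0, 0, 0]

/-! ### Trace of the connection and the Ricci identity -/

section Contraction

variable {m a r θ : ℝ}

lemma kerrGamma_symm (m a r θ : ℝ) (l μ ν : Fin 4) :
    kerrGamma m a r θ l μ ν = kerrGamma m a r θ l ν μ := by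
  fin_cases l <;> fin_cases μ <;> fin_cases ν <;> rfl

/-- The gradient of log (ρ² sin θ): all dependence on m and Δ cancels in the trace. -/
lemma sum_kerrGamma (hS : rhoSq a r θ ≠ 0) (hD : horizonPoly m a r ≠ 0) (hs : Real.sin θ ≠ 0)
    (μ : Fin 4) : ∑ l, kerrGamma m a r θ l μ l = kerrLogVolDeriv a r θ μ := by
  have eS : rhoSq a r θ = r ^ 2 + a ^ 2 * Real.cos θ ^ 2 := rfl
  have eD : horizonPoly m a r = r ^ 2 + a ^ 2 - 2 * m * r := rfl
  have h2 := Real.sin_sq θ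
  fin_cases μ <;>
    simp only [kerrGamma, kerrLogVolDeriv, Matrix.of_apply, Matrix.cons_val', Matrix.cons_val,
      Fin.reduceFinMk, Fin.zero_eta, Fin.mk_one, Fin.isValue, Fin.sum_univ_four, add_zero,
      Matrix.cons_val_zero, Matrix.cons_val_one] <;>
    field_simp
  · rw [eS, eD]
    ring_nf
    simp only [h2]
    ring
  · ring

lemma hasDerivAt_logVolDeriv_r (hS : rhoSq a r θ ≠ 0) (μ : Fin 4) :
    HasDerivAt (fun r => kerrLogVolDeriv a r θ μ) (kerrLogVolHess a r θ 1 μ) r := by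
  fin_cases μ <;>
    simp only [kerrLogVolDeriv, kerrLogVolHess, Matrix.of_apply, Matrix.cons_val',
      Matrix.cons_val, Fin.reduceFinMk, Fin.zero_eta, Fin.mk_one, Fin.isValue,
      Matrix.cons_val_zero, Matrix.cons_val_one] <;>
    refine HasDerivAt.congr_deriv (by
      repeat' with_reducible first
        | exact hS
        | exact hasDerivAt_const _ _
        | exact hasDerivAt_rhoSq_r _ _ _
        | exact hasDerivAt_id' _
        | apply HasDerivAt.fun_sub
        | apply HasDerivAt.fun_div
        | apply HasDerivAt.fun_mul) ?_ <;> field_simp <;> ring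

lemma hasDerivAt_logVolDeriv_theta (hS : rhoSq a r θ ≠ 0) (hs : Real.sin θ ≠ 0) (μ : Fin 4) :
    HasDerivAt (fun θ => kerrLogVolDeriv a r θ μ) (kerrLogVolHess a r θ 2 μ) θ := by
  have h2 := Real.cos_sq' θ
  fin_cases μ <;>
    simp only [kerrLogVolDeriv, kerrLogVolHess, Matrix.of_apply, Matrix.cons_val',
      Matrix.cons_val, Fin.reduceFinMk, Fin.zero_eta, Fin.mk_one, Fin.isValue,
      Matrix.cons_val_zero, Matrix.cons_val_one] <;>
    refine HasDerivAt.congr_deriv (by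
      repeat' with_reducible first
        | exact hS
        | exact hs
        | exact hasDerivAt_const _ _
        | exact hasDerivAt_rhoSq_theta _ _ _
        | exact Real.hasDerivAt_sin _
        | exact Real.hasDerivAt_cos _
        | apply HasDerivAt.fun_sub
        | apply HasDerivAt.fun_div
        | apply HasDerivAt.fun_mul) ?_ <;> field_simp <;> first
          | ring1
          | (rw [h2]; ring)

/-- The Ricci tensor of the Kerr metric, in terms of its Christoffel symbols, vanishes. -/
lemma kerrGamma_ricci (hS : rhoSq a r θ ≠ 0) (hD : horizonPoly m a r ≠ 0) (hs : Real.sin θ ≠ 0)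
    (μ ν : Fin 4) :
    kerrGammaDr m a r θ μ ν + kerrGammaDtheta m a r θ μ ν - kerrLogVolHess a r θ ν μ
      + ∑ σ, kerrLogVolDeriv a r θ σ * kerrGamma m a r θ σ μ ν
      - ∑ l, ∑ σ, kerrGamma m a r θ l ν σ * kerrGamma m a r θ σ μ l = 0 := by
  have eS : rhoSq a r θ = r ^ 2 + a ^ 2 * Real.cos θ ^ 2 := rfl
  have eD : horizonPoly m a r = r ^ 2 + a ^ 2 - 2 * m * r := rfl
  have h2 := Real.sin_sq θ
  have h4 : Real.sin θ ^ 4 = (1 - Real.cos θ ^ 2) ^ 2 := by rw [← h2]; ring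
  have h6 : Real.sin θ ^ 6 = (1 - Real.cos θ ^ 2) ^ 3 := by rw [← h2]; ring
  fin_cases μ <;> fin_cases ν <;>
    simp only [kerrGamma, kerrLogVolDeriv, kerrGammaDr, kerrGammaDtheta, kerrLogVolHess,
      Matrix.of_apply, Matrix.cons_val', Matrix.cons_val, Fin.sum_univ_four,
      Fin.reduceFinMk, Fin.zero_eta, Fin.mk_one, Fin.isValue, mul_zero, zero_mul, add_zero,
      zero_add, sub_zero, sub_self] <;>
    -- Sine, cosine, ρ² and Δ become independent variables while denominators are cleared. Their
    -- relations are restored afterwards, and even powers of sine are eliminated last.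
    generalize Real.sin θ = s at * <;> generalize Real.cos θ = c at * <;>
    generalize rhoSq a r θ = S at * <;> generalize horizonPoly m a r = D at * <;>
    field_simp <;> rw [eS] <;> (try rw [eD]) <;> ring_nf <;>
    (try simp only [h2, h4, h6]) <;> ring1

end Contraction

/-! ### Ricci flatness -/

section Ricci

variable {p : Params} {x : Point}

lemma pd_kerrGamma_diag (hp : p ∈ blackHoles) (hx : x ∈ exterior p) (μ ν : Fin 4) :
    ∑ l, pd ν (fun y => (kerr p).christoffel y l μ l) x
      = kerrLogVolHess (p 1) (x 1) (x 2) ν μ := by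
  obtain ⟨hS, hD, hs⟩ := exterior_pos hp hx
  have hcongr : ∀ l, pd ν (fun y => (kerr p).christoffel y l μ l) x
      = pd ν (fun y => kerrGamma (p 0) (p 1) (y 1) (y 2) l μ l) x := fun l =>
    pd_congr (isOpen_exterior p) (fun y hy => christoffel_kerr hp hy l μ l) hx ν
  simp only [hcongr]
  have h0 : kerrLogVolHess (p 1) (x 1) (x 2) 0 μ = 0 := by fin_cases μ <;> rfl
  have h3 : kerrLogVolHess (p 1) (x 1) (x 2) 3 μ = 0 := by fin_cases μ <;> rfl
  have hS' : ∀ᶠ r in 𝓝 (x 1), rhoSq (p 1) r (x 2) ≠ 0 :=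
    (hasDerivAt_rhoSq_r _ _ _).continuousAt.eventually_ne hS.ne'
  have hD' : ∀ᶠ r in 𝓝 (x 1), horizonPoly (p 0) (p 1) r ≠ 0 :=
    (hasDerivAt_horizonPoly_r _ _ _).continuousAt.eventually_ne hD.ne'
  have hS'' : ∀ᶠ θ in 𝓝 (x 2), rhoSq (p 1) (x 1) θ ≠ 0 :=
    (hasDerivAt_rhoSq_theta _ _ _).continuousAt.eventually_ne hS.ne'
  have hs' : ∀ᶠ θ in 𝓝 (x 2), Real.sin θ ≠ 0 :=
    Real.continuous_sin.continuousAt.eventually_ne hs.ne'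
  fin_cases ν
  · refine (Finset.sum_eq_zero fun l _ => ?_).trans h0.symm
    exact pd_t (fun r θ => kerrGamma (p 0) (p 1) r θ l μ l) x
  · have h : ∀ l, HasDerivAt (fun r => kerrGamma (p 0) (p 1) r (x 2) l μ l)
        (pd 1 (fun y => kerrGamma (p 0) (p 1) (y 1) (y 2) l μ l) x) (x 1) := fun l => by
      have := (differentiableAt_gamma_r hS.ne' hD.ne' hs.ne' l μ).hasDerivAt
      rwa [← pd_r (F := fun r θ => kerrGamma (p 0) (p 1) r θ l μ l) this] at this
    -- The trace is differentiated in two ways, term by term and through its closed form. The closed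
    -- form holds near r because ρ² and Δ stay nonzero there.
    refine (HasDerivAt.fun_sum fun l (_ : l ∈ Finset.univ) => h l).unique ?_
    refine (hasDerivAt_logVolDeriv_r hS.ne' μ).congr_of_eventuallyEq ?_
    filter_upwards [hS', hD'] with r h1 h2 using sum_kerrGamma h1 h2 hs.ne' μ
  · have h : ∀ l, HasDerivAt (fun θ => kerrGamma (p 0) (p 1) (x 1) θ l μ l)
        (pd 2 (fun y => kerrGamma (p 0) (p 1) (y 1) (y 2) l μ l) x) (x 2) := fun l => by
      have := (differentiableAt_gamma_theta hS.ne' hD.ne' hs.ne' l μ).hasDerivAt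
      rwa [← pd_theta (F := fun r θ => kerrGamma (p 0) (p 1) r θ l μ l) this] at this
    refine (HasDerivAt.fun_sum fun l (_ : l ∈ Finset.univ) => h l).unique ?_
    refine (hasDerivAt_logVolDeriv_theta hS.ne' hs.ne' μ).congr_of_eventuallyEq ?_
    filter_upwards [hS'', hs'] with θ h1 h2 using sum_kerrGamma h1 hD.ne' h2 μ
  · refine (Finset.sum_eq_zero fun l _ => ?_).trans h3.symm
    exact pd_phi (fun r θ => kerrGamma (p 0) (p 1) r θ l μ l) x

lemma sum_pd_kerrGamma (hp : p ∈ blackHoles) (hx : x ∈ exterior p) (μ ν : Fin 4) :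
    ∑ l, pd l (fun y => (kerr p).christoffel y l μ ν) x
      = kerrGammaDr (p 0) (p 1) (x 1) (x 2) μ ν + kerrGammaDtheta (p 0) (p 1) (x 1) (x 2) μ ν := by
  obtain ⟨hS, hD, hs⟩ := exterior_pos hp hx
  have hcongr : ∀ l, pd l (fun y => (kerr p).christoffel y l μ ν) x
      = pd l (fun y => kerrGamma (p 0) (p 1) (y 1) (y 2) l μ ν) x := fun l =>
    pd_congr (isOpen_exterior p) (fun y hy => christoffel_kerr hp hy l μ ν) hx l
  simp only [hcongr, Fin.sum_univ_four]
  rw [pd_t (fun r θ => kerrGamma (p 0) (p 1) r θ 0 μ ν),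
    pd_phi (fun r θ => kerrGamma (p 0) (p 1) r θ 3 μ ν),
    pd_r (F := fun r θ => kerrGamma (p 0) (p 1) r θ 1 μ ν) (hasDerivAt_gamma_r hS.ne' hD.ne' μ ν),
    pd_theta (F := fun r θ => kerrGamma (p 0) (p 1) r θ 2 μ ν)
      (hasDerivAt_gamma_theta hS.ne' hD.ne' μ ν)]
  ring

/-- The Kerr metric is Ricci flat. -/
theorem ricci_kerr (hp : p ∈ blackHoles) (hx : x ∈ exterior p) (μ ν : Fin 4) :
    (kerr p).ricci x μ ν = 0 := by
  obtain ⟨hS, hD, hs⟩ := exterior_pos hp hx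
  rw [← kerrGamma_ricci (m := p 0) hS.ne' hD.ne' hs.ne' μ ν]
  unfold Fields.ricci
  rw [Finset.sum_sub_distrib, sum_pd_kerrGamma hp hx, pd_kerrGamma_diag hp hx]
  simp only [christoffel_kerr hp hx, Finset.sum_sub_distrib]
  -- Summing over l first turns Γ^l_{lσ} into ∂_σ log √(-g).
  have : ∑ l, ∑ σ, kerrGamma (p 0) (p 1) (x 1) (x 2) l l σ * kerrGamma (p 0) (p 1) (x 1) (x 2) σ μ ν
      = ∑ σ, kerrLogVolDeriv (p 1) (x 1) (x 2) σ * kerrGamma (p 0) (p 1) (x 1) (x 2) σ μ ν := by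
    rw [Finset.sum_comm]
    refine Finset.sum_congr rfl fun σ _ => ?_
    rw [← sum_kerrGamma (m := p 0) hS.ne' hD.ne' hs.ne', Finset.sum_mul]
    exact Finset.sum_congr rfl fun l _ => by rw [kerrGamma_symm _ _ _ _ l l σ]
  rw [this]
  ring

end Ricci

/-! ### Field equations and symmetries -/

/-- All derivatives of φ and e^{-φ} vanish. What remains is R_{μν} in the metric equation and R in
the dilaton equation. -/
theorem kerr_solvesEOM {p : Params} (hp : p ∈ blackHoles) (G : ℝ) :
    (kerr p).SolvesEOM G (exterior p) := by
  intro x hx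
  have hdil : (kerr p).dilaton = fun _ => p 2 := rfl
  have hcpl : (kerr p).coupling = fun _ => Real.exp (-p 2) := rfl
  have hpd : ∀ (k : ℝ) (i : Fin 4), pd i (fun _ : Point => k) = fun _ => 0 :=
    fun k i => funext fun x => pd_const i k x
  have hL : (kerr p).lagrangian x G = 0 := by
    simp [Fields.lagrangian, Fields.scalarCurvature, ricci_kerr hp hx, Fields.gradSq, hdil]
  refine ⟨fun μ ν => ?_, ?_⟩
  · simp [Fields.eomMetric, hL, ricci_kerr hp hx, Fields.hess, Fields.box, hdil, hcpl, hpd]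
  · simp [Fields.eomDilaton, hL, Fields.box, Fields.gradSq, Fields.hess, hdil, hpd]

/-- The metric does not depend on t or ϕ and the generator has constant components, so each term of
the Lie derivative vanishes. -/
theorem kerr_isExactSymmetry (p : Params) (u w : ℝ) (D : Set Point) :
    (kerr p).IsExactSymmetry (stationaryAxial u w) D := by
  intro x _
  refine ⟨fun μ ν => ?_, ?_⟩
  · have h0 : pd 0 (fun y => (kerr p).metric y μ ν) x = 0 :=
      pd_t (fun r θ => circular (gtt (p 0) (p 1) r θ) (gtp (p 0) (p 1) r θ)
        (gpp (p 0) (p 1) r θ) (grr (p 0) (p 1) r θ) (rhoSq (p 1) r θ) μ ν) x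
    have h3 : pd 3 (fun y => (kerr p).metric y μ ν) x = 0 :=
      pd_phi (fun r θ => circular (gtt (p 0) (p 1) r θ) (gtp (p 0) (p 1) r θ)
        (gpp (p 0) (p 1) r θ) (grr (p 0) (p 1) r θ) (rhoSq (p 1) r θ) μ ν) x
    simp [Fields.lieMetric, stationaryAxial, Fin.sum_univ_four, h0, h3]
  · simp [Fields.lieDilaton, kerr]

/-! ### Geometry of the horizon -/

section Horizon

variable {p : Params}

/-- This is Δ(r_H) = 0, the relation behind all simplifications at the horizon. -/
lemma horizonRadius_sq (hp : p ∈ blackHoles) :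
    horizonRadius p ^ 2 + p 1 ^ 2 = 2 * p 0 * horizonRadius p := by
  have := horizonPoly_factor hp (horizonRadius p)
  rw [sub_self, zero_mul] at this
  unfold horizonPoly at this
  linarith

lemma angularVelocityH_mul (hp : p ∈ blackHoles) :
    angularVelocityH p * (horizonRadius p ^ 2 + p 1 ^ 2) = p 1 := by
  have h1 := (mass_pos hp).ne'
  have h2 := (horizonRadius_pos hp).ne'
  rw [horizonRadius_sq hp, angularVelocityH]
  field_simp

/-- Neither component contains Δ, so the quotient is continuous across r_H. There ρ² + a² sin² θ =
r_H² + a² = 2 m r_H, and the dependence on θ cancels. -/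
theorem hasAngularVelocity_horizon (hp : p ∈ blackHoles) :
    HasAngularVelocity p (𝓝[>] horizonRadius p) (angularVelocityH p) := by
  intro t ϕ θ hθ
  have hrH := horizonRadius_pos hp
  have hs := Real.sin_pos_of_mem_Ioo hθ
  have hS := rhoSq_pos (p 1) hrH θ
  have hm := mass_pos hp
  have e := horizonRadius_sq hp
  change Tendsto (fun r => -(gtp (p 0) (p 1) r θ) / gpp (p 0) (p 1) r θ) _ _
  have hg : 0 < gpp (p 0) (p 1) (horizonRadius p) θ := by unfold gpp; positivity
  have hc : ContinuousAt (fun r => rhoSq (p 1) r θ) (horizonRadius p) :=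
    (hasDerivAt_rhoSq_r _ _ _).continuousAt
  have hc' : ContinuousAt (fun r => -(gtp (p 0) (p 1) r θ) / gpp (p 0) (p 1) r θ)
      (horizonRadius p) := by
    refine ContinuousAt.div ?_ ?_ hg.ne' <;> simp only [gtp, gpp] <;>
      fun_prop (disch := exact hS.ne')
  have hv : -(gtp (p 0) (p 1) (horizonRadius p) θ) / gpp (p 0) (p 1) (horizonRadius p) θ
      = angularVelocityH p := by
    rw [div_eq_iff hg.ne']
    have e2 : rhoSq (p 1) (horizonRadius p) θ + p 1 ^ 2 * Real.sin θ ^ 2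
        = 2 * p 0 * horizonRadius p := by
      rw [← e, rhoSq, Real.sin_sq]; ring
    unfold gtp gpp angularVelocityH
    rw [e]
    field_simp
    linear_combination -p 1 * e2
  rw [← hv]
  exact hc'.tendsto.mono_left nhdsWithin_le_nhds

/-- For r ≥ 1 one has ρ² ≥ 1 and g_{ϕϕ} ≥ r² sin² θ, so the quotient is at most 2 m |a| / r in
absolute value. -/
theorem hasAngularVelocity_infinity (hp : p ∈ blackHoles) :
    HasAngularVelocity p atTop (angularVelocityInfty p) := by
  intro t ϕ θ hθ
  have hs := Real.sin_pos_of_mem_Ioo hθ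
  have hm := mass_pos hp
  change Tendsto (fun r => -(gtp (p 0) (p 1) r θ) / gpp (p 0) (p 1) r θ) _ (𝓝 0)
  have hlim : Tendsto (fun r : ℝ => 2 * p 0 * |p 1| / r) atTop (𝓝 0) :=
    tendsto_const_nhds.div_atTop tendsto_id
  refine squeeze_zero_norm' ?_ hlim
  filter_upwards [eventually_ge_atTop (1 : ℝ)] with r hr
  have hr0 : 0 < r := by linarith
  have hS := rhoSq_pos (p 1) hr0 θ
  have hS1 : 1 ≤ rhoSq (p 1) r θ := by
    unfold rhoSq
    nlinarith [mul_nonneg (sq_nonneg (p 1)) (sq_nonneg (Real.cos θ))]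
  have hg : r ^ 2 * Real.sin θ ^ 2 ≤ gpp (p 0) (p 1) r θ := by
    unfold gpp
    gcongr
    have h1 : 0 ≤ p 1 ^ 2 := sq_nonneg _
    have h2 : 0 ≤ 2 * p 0 * r / rhoSq (p 1) r θ * p 1 ^ 2 * Real.sin θ ^ 2 := by positivity
    linarith
  rw [norm_div, norm_neg, Real.norm_eq_abs, Real.norm_eq_abs,
    abs_of_pos (lt_of_lt_of_le (by positivity) hg), div_le_div_iff₀
      (lt_of_lt_of_le (by positivity) hg) hr0]
  have h3 : |gtp (p 0) (p 1) r θ| = 2 * p 0 * r / rhoSq (p 1) r θ * |p 1| * Real.sin θ ^ 2 := by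
    unfold gtp
    rw [abs_neg, abs_mul, abs_mul,
      abs_of_pos (show 0 < 2 * p 0 * r / rhoSq (p 1) r θ by positivity),
      abs_of_pos (show 0 < Real.sin θ ^ 2 by positivity)]
  have h4 : 2 * p 0 * r / rhoSq (p 1) r θ ≤ 2 * p 0 * r := div_le_self (by positivity) hS1
  rw [h3]
  calc 2 * p 0 * r / rhoSq (p 1) r θ * |p 1| * Real.sin θ ^ 2 * r
      ≤ 2 * p 0 * r * |p 1| * Real.sin θ ^ 2 * r := by gcongr
    _ = 2 * p 0 * |p 1| * (r ^ 2 * Real.sin θ ^ 2) := by ring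
    _ ≤ 2 * p 0 * |p 1| * gpp (p 0) (p 1) r θ := by gcongr

/-! ### Axisymmetric integrals over the sphere and the horizon area -/

lemma integrableOn_angles {f : ℝ → ℝ} (hf : IntegrableOn f (Ioo 0 Real.pi)) :
    IntegrableOn (fun q : ℝ × ℝ => f q.1) angles := by
  have h1 : IntegrableOn (fun _ : ℝ => (1 : ℝ)) (Ioo 0 (2 * Real.pi)) :=
    continuous_const.integrableOn_Icc.mono_set Ioo_subset_Icc_self
  have := Integrable.mul_prod hf h1
  simpa [IntegrableOn, angles, Measure.volume_eq_prod, Measure.prod_restrict] using this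

lemma setIntegral_angles (f : ℝ → ℝ) :
    ∫ q in angles, f q.1 = 2 * Real.pi * ∫ θ in (0)..Real.pi, f θ := by
  have h := setIntegral_prod_mul (μ := volume) (ν := volume) f (fun _ : ℝ => (1 : ℝ))
    (Ioo 0 Real.pi) (Ioo 0 (2 * Real.pi))
  simp only [mul_one] at h
  rw [angles, Measure.volume_eq_prod, h, intervalIntegral.integral_of_le Real.pi_pos.le,
    integral_Ioc_eq_integral_Ioo]
  simp [Real.pi_pos.le, mul_comm]

lemma measurableSet_angles : MeasurableSet angles := measurableSet_Ioo.prod measurableSet_Ioo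

/-- At r_H the area density √(g_{θθ} g_{ϕϕ}) collapses to (r_H² + a²) sin θ. -/
theorem horizonArea_eq (hp : p ∈ blackHoles) :
    horizonArea p = 4 * Real.pi * (horizonRadius p ^ 2 + p 1 ^ 2) := by
  have hrH := horizonRadius_pos hp
  have e := horizonRadius_sq hp
  have h : horizonArea p
      = ∫ q in angles, (horizonRadius p ^ 2 + p 1 ^ 2) * Real.sin q.1 := by
    refine setIntegral_congr_fun measurableSet_angles fun q hq => ?_
    have hs := Real.sin_pos_of_mem_Ioo hq.1
    have hS := rhoSq_pos (p 1) hrH q.1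
    have e2 : rhoSq (p 1) (horizonRadius p) q.1 + p 1 ^ 2 * Real.sin q.1 ^ 2
        = horizonRadius p ^ 2 + p 1 ^ 2 := by
      rw [rhoSq, Real.sin_sq]; ring
    change √(rhoSq (p 1) (horizonRadius p) q.1 * gpp (p 0) (p 1) (horizonRadius p) q.1 - 0 ^ 2) = _
    rw [← Real.sqrt_sq (show 0 ≤ (horizonRadius p ^ 2 + p 1 ^ 2) * Real.sin q.1 by positivity)]
    congr 1
    unfold gpp
    rw [← e]
    field_simp
    linear_combination (horizonRadius p ^ 2 + p 1 ^ 2) * Real.sin q.1 ^ 2 * e2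
  rw [h, setIntegral_angles (fun θ => (horizonRadius p ^ 2 + p 1 ^ 2) * Real.sin θ)]
  simp only [intervalIntegral.integral_const_mul, integral_sin, Real.cos_zero, Real.cos_pi]
  ring

lemma horizonArea_eq' (hp : p ∈ blackHoles) :
    horizonArea p = 8 * Real.pi * p 0 * horizonRadius p := by
  rw [horizonArea_eq hp, horizonRadius_sq hp]; ring

/-- `ρ² N / (r - r_H)`, where `N` is the squared norm of the horizon generator. -/
def redshiftNum (p : Params) (r θ : ℝ) : ℝ :=
  Real.sin θ ^ 2 * angularVelocityH p ^ 2 * (r - horizonRadius p) * (r + horizonRadius p) ^ 2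
    - (r - horizonRadius p + 2 * Real.sqrt (p 0 ^ 2 - p 1 ^ 2))
      * (1 - p 1 * angularVelocityH p * Real.sin θ ^ 2) ^ 2

/-- For any Ω, ρ² N = sin² θ ((r² + a²) Ω - a)² - Δ (1 - a Ω sin² θ)². With Ω = Ω_H the first
bracket vanishes at r_H, as does Δ, so r - r_H can be pulled out. -/
lemma normSq_horizonGenerator (hp : p ∈ blackHoles) {x : Point} (hx : 0 < x 1) :
    normSq p (stationaryAxial 1 (angularVelocityH p)) x
      = (x 1 - horizonRadius p) * (redshiftNum p (x 1) (x 2) / rhoSq (p 1) (x 1) (x 2)) := by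
  have hS := rhoSq_pos (p 1) hx (x 2)
  have e := angularVelocityH_mul hp
  have eD := horizonPoly_factor hp (x 1)
  have eS : rhoSq (p 1) (x 1) (x 2) = x 1 ^ 2 + p 1 ^ 2 * (1 - Real.sin (x 2) ^ 2) := by
    rw [rhoSq, Real.cos_sq']
  have h : normSq p (stationaryAxial 1 (angularVelocityH p)) x
      = gtt (p 0) (p 1) (x 1) (x 2) + 2 * angularVelocityH p * gtp (p 0) (p 1) (x 1) (x 2)
        + angularVelocityH p ^ 2 * gpp (p 0) (p 1) (x 1) (x 2) := by
    simp [normSq, kerrMetric_eq, circular, stationaryAxial, Fin.sum_univ_four]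
    ring
  have e1 : (x 1 ^ 2 + p 1 ^ 2) * angularVelocityH p - p 1
      = angularVelocityH p * (x 1 - horizonRadius p) * (x 1 + horizonRadius p) := by
    linear_combination e
  have h2 : (x 1 - horizonRadius p) * redshiftNum p (x 1) (x 2)
      = Real.sin (x 2) ^ 2 * ((x 1 ^ 2 + p 1 ^ 2) * angularVelocityH p - p 1) ^ 2
        - horizonPoly (p 0) (p 1) (x 1)
          * (1 - p 1 * angularVelocityH p * Real.sin (x 2) ^ 2) ^ 2 := by
    rw [e1, eD, redshiftNum]; ring
  rw [h, ← mul_div_assoc, h2]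
  unfold gtt gtp gpp horizonPoly
  field_simp
  rw [eS]
  ring

lemma hasDerivAt_redshiftNum_r (p : Params) (r θ : ℝ) :
    HasDerivAt (fun r => redshiftNum p r θ)
      (Real.sin θ ^ 2 * angularVelocityH p ^ 2 * ((r + horizonRadius p) ^ 2
        + 2 * (r - horizonRadius p) * (r + horizonRadius p))
        - (1 - p 1 * angularVelocityH p * Real.sin θ ^ 2) ^ 2) r := by
  unfold redshiftNum
  refine HasDerivAt.congr_deriv (by
      repeat' with_reducible first
        | exact hasDerivAt_const _ _
        | exact hasDerivAt_id' _
        | apply HasDerivAt.fun_sub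
        | apply HasDerivAt.fun_add
        | apply HasDerivAt.fun_pow
        | apply HasDerivAt.fun_mul) ?_
  ring

lemma hasDerivAt_redshiftNum_theta (p : Params) (r θ : ℝ) :
    HasDerivAt (fun θ => redshiftNum p r θ)
      (2 * Real.sin θ * Real.cos θ * (angularVelocityH p ^ 2 * (r - horizonRadius p)
          * (r + horizonRadius p) ^ 2
        + (r - horizonRadius p + 2 * Real.sqrt (p 0 ^ 2 - p 1 ^ 2))
          * (2 * p 1 * angularVelocityH p * (1 - p 1 * angularVelocityH p * Real.sin θ ^ 2))))
      θ := by
  unfold redshiftNum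
  refine HasDerivAt.congr_deriv (by
      repeat' with_reducible first
        | exact hasDerivAt_const _ _
        | exact Real.hasDerivAt_sin _
        | apply HasDerivAt.fun_sub
        | apply HasDerivAt.fun_add
        | apply HasDerivAt.fun_pow
        | apply HasDerivAt.fun_mul) ?_
  ring

/-- Write N = (r - r_H) K with K smooth and negative at r_H. Since g^{rr} also carries a factor r -
r_H, one such factor cancels in the quotient. The θ derivative contributes a term that tends to 0,
and the limit is -√(m² - a²) K / (2ρ²) at r_H. -/
theorem hasHorizonSurfaceGravity (hp : p ∈ blackHoles) :
    HasHorizonSurfaceGravity p (stationaryAxial 1 (angularVelocityH p)) (surfaceGravity p) := by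
  have hm := mass_pos hp
  have hrH := horizonRadius_pos hp
  have hd := sqrt_pos_of_blackHole hp
  refine ⟨by unfold surfaceGravity; positivity, fun t ϕ θ hθ => ?_⟩
  have hs := Real.sin_pos_of_mem_Ioo hθ
  set rH := horizonRadius p with hrH_def
  set d := Real.sqrt (p 0 ^ 2 - p 1 ^ 2) with hd_def
  set N := normSq p (stationaryAxial 1 (angularVelocityH p)) with hN_def
  let K : ℝ → ℝ → ℝ := fun r θ => redshiftNum p r θ / rhoSq (p 1) r θ
  let F : ℝ → ℝ → ℝ := fun r θ => (r - rH) * K r θ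
  have hS := rhoSq_pos (p 1) hrH θ
  have hUo : IsOpen {x : Point | 0 < x 1} := isOpen_lt continuous_const (continuous_apply 1)
  have hNeq : EqOn N (fun y => (y 1 - rH) * K (y 1) (y 2)) {x : Point | 0 < x 1} :=
    fun y hy => normSq_horizonGenerator hp hy
  -- Here 1 - a Ω_H sin² θ = ρ² / (2 m r_H), which makes K proportional to ρ² and the limit
  -- independent of θ.
  have hKH : K rH θ = -(2 * d * rhoSq (p 1) rH θ / (2 * p 0 * rH) ^ 2) := by
    have e1 : 1 - p 1 * angularVelocityH p * Real.sin θ ^ 2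
        = rhoSq (p 1) rH θ / (2 * p 0 * rH) := by
      have e2 : rhoSq (p 1) rH θ + p 1 ^ 2 * Real.sin θ ^ 2 = 2 * p 0 * rH := by
        rw [← horizonRadius_sq hp, rhoSq, Real.sin_sq]; ring
      rw [angularVelocityH, ← hrH_def]
      field_simp
      linear_combination -e2
    simp only [K, redshiftNum, ← hrH_def, ← hd_def, e1]
    field_simp
    ring
  have hKneg : K rH θ < 0 := by rw [hKH]; exact neg_neg_of_pos (by positivity)
  have hcS : ContinuousAt (fun r => rhoSq (p 1) r θ) rH := (hasDerivAt_rhoSq_r _ _ _).continuousAt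
  have hcK : ContinuousAt (fun r => K r θ) rH :=
    (hasDerivAt_redshiftNum_r p rH θ).continuousAt.div hcS hS.ne'
  have hcr : ContinuousAt (fun r => r - rH) rH := by fun_prop
  have hKr : ∃ K' : ℝ → ℝ, ContinuousAt K' rH ∧
      ∀ r, 0 < r → HasDerivAt (fun r => K r θ) (K' r) r := by
    refine ⟨_, ?_, fun r hr => (hasDerivAt_redshiftNum_r p r θ).div (hasDerivAt_rhoSq_r _ _ _)
      (rhoSq_pos (p 1) hr θ).ne'⟩
    have := (hasDerivAt_redshiftNum_r p rH θ).continuousAt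
    fun_prop (disch := exact pow_ne_zero 2 hS.ne')
  have hKθ : ∃ K' : ℝ → ℝ, ContinuousAt K' rH ∧
      ∀ r, 0 < r → HasDerivAt (fun θ => K r θ) (K' r) θ := by
    refine ⟨_, ?_, fun r hr => (hasDerivAt_redshiftNum_theta p r θ).div
      (hasDerivAt_rhoSq_theta _ _ _) (rhoSq_pos (p 1) hr θ).ne'⟩
    have := (hasDerivAt_redshiftNum_r p rH θ).continuousAt
    fun_prop (disch := exact pow_ne_zero 2 hS.ne')
  obtain ⟨Kr, hKrc, hKr⟩ := hKr
  obtain ⟨Kθ, hKθc, hKθ⟩ := hKθ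
  have hgt : ∀ᶠ r in 𝓝[>] rH, rH < r := eventually_mem_nhdsWithin
  have hKev : ∀ᶠ r in 𝓝[>] rH, K r θ < 0 :=
    (hcK.eventually_lt_const hKneg).filter_mono nhdsWithin_le_nhds
  have hNval : ∀ r, 0 < r → N ![t, r, θ, ϕ] = (r - rH) * K r θ :=
    fun r hr => hNeq (x := ![t, r, θ, ϕ]) hr
  refine ⟨?_, ?_, ?_⟩
  · have h0 : Tendsto (fun r => (r - rH) * K r θ) (𝓝[>] rH) (𝓝 0) := by
      have := (hcr.fun_mul hcK).tendsto.mono_left (nhdsWithin_le_nhds (s := Ioi rH))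
      simpa using this
    refine h0.congr' ?_
    filter_upwards [hgt] with r hr using (hNval r (hrH.trans hr)).symm
  · filter_upwards [hgt, hKev] with r hr hK
    rw [hNval r (hrH.trans hr)]
    exact mul_neg_of_pos_of_neg (sub_pos.2 hr) hK
  · have hlim : ContinuousAt (fun r => -((r - rH + 2 * d) * (K r θ + (r - rH) * Kr r) ^ 2
        + (r - rH) * Kθ r ^ 2) / (4 * rhoSq (p 1) r θ * K r θ)) rH := by
      refine ContinuousAt.div (by fun_prop) (by fun_prop) ?_
      exact mul_ne_zero (by positivity) hKneg.ne
    have hval : -((rH - rH + 2 * d) * (K rH θ + (rH - rH) * Kr rH) ^ 2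
        + (rH - rH) * Kθ rH ^ 2) / (4 * rhoSq (p 1) rH θ * K rH θ) = surfaceGravity p ^ 2 := by
      have h1 : -((rH - rH + 2 * d) * (K rH θ + (rH - rH) * Kr rH) ^ 2
        + (rH - rH) * Kθ rH ^ 2) / (4 * rhoSq (p 1) rH θ * K rH θ)
          = -(d * K rH θ) / (2 * rhoSq (p 1) rH θ) := by
        have := hKneg.ne
        field_simp
        ring
      rw [h1, hKH, surfaceGravity, ← hrH_def, ← hd_def]
      field_simp
    have hT := hlim.tendsto.mono_left (nhdsWithin_le_nhds (s := Ioi rH))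
    rw [hval] at hT
    refine hT.congr' ?_
    filter_upwards [hgt, hKev] with r hr hK
    have hr0 := hrH.trans hr
    have hx : (![t, r, θ, ϕ] : Point) ∈ exterior p := ⟨hr, hθ⟩
    have hpd : ∀ i, pd i N ![t, r, θ, ϕ]
        = pd i (fun y => F (y 1) (y 2)) ![t, r, θ, ϕ] :=
      pd_congr hUo hNeq hr0
    have hp1 : pd 1 N ![t, r, θ, ϕ] = K r θ + (r - rH) * Kr r := by
      rw [hpd]
      refine pd_r (F := F) (x := ![t, r, θ, ϕ]) ?_
      have := ((hasDerivAt_id' r).sub_const rH).fun_mul (hKr r hr0)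
      rwa [one_mul] at this
    have hp2 : pd 2 N ![t, r, θ, ϕ] = (r - rH) * Kθ r := by
      rw [hpd]
      exact pd_theta (F := F) (x := ![t, r, θ, ϕ]) ((hKθ r hr0).const_mul (r - rH))
    have hp0 : pd 0 N ![t, r, θ, ϕ] = 0 := by rw [hpd]; exact pd_t F _
    have hp3 : pd 3 N ![t, r, θ, ϕ] = 0 := by rw [hpd]; exact pd_phi F _
    have hinv := kerr_inv hp hx
    have h11 : (kerr p).inv ![t, r, θ, ϕ] 1 1 = (r - rH) * (r - rH + 2 * d) / rhoSq (p 1) r θ := by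
      rw [hinv, ← horizonPoly_factor hp]; rfl
    have h22 : (kerr p).inv ![t, r, θ, ϕ] 2 2 = 1 / rhoSq (p 1) r θ := by rw [hinv]; rfl
    have h12 : (kerr p).inv ![t, r, θ, ϕ] 1 2 = 0 := by rw [hinv]; rfl
    have h21 : (kerr p).inv ![t, r, θ, ϕ] 2 1 = 0 := by rw [hinv]; rfl
    simp only [Fields.grad, Fin.sum_univ_four, hp0, hp1, hp2, hp3, h11, h22, h12, h21,
      hNval r hr0]
    have hSr := (rhoSq_pos (p 1) hr0 θ).ne'
    have h1 : r - rH ≠ 0 := (sub_pos.2 hr).ne'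
    have h2 := hK.ne
    field_simp
    ring

end Horizon

/-! ### The parametric variation of the Kerr metric -/

/-- Variation of `f = 2 m r / ρ²` under `(δm, δa)`. -/
def varF (m a M α r θ : ℝ) : ℝ :=
  2 * r * M / rhoSq a r θ - 4 * m * r * a * α * Real.cos θ ^ 2 / rhoSq a r θ ^ 2

/-- `∂_r` of the variation of `f`. -/
def varFDr (m a M α r θ : ℝ) : ℝ :=
  2 * M / rhoSq a r θ - 4 * r ^ 2 * M / rhoSq a r θ ^ 2
    - 4 * m * a * α * Real.cos θ ^ 2 / rhoSq a r θ ^ 2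
    + 16 * m * r ^ 2 * a * α * Real.cos θ ^ 2 / rhoSq a r θ ^ 3

/-- The variation `h_{μν}` of the Kerr metric under `(δm, δa)`. -/
def varMetric (m a M α r θ : ℝ) : Matrix (Fin 4) (Fin 4) ℝ :=
  let s := Real.sin θ
  let S := rhoSq a r θ
  let D := horizonPoly m a r
  circular (varF m a M α r θ) (-((varF m a M α r θ * a + 2 * m * r / S * α) * s ^ 2))
    ((2 * a * α + varF m a M α r θ * a ^ 2 * s ^ 2 + 2 * m * r / S * (2 * a * α) * s ^ 2) * s ^ 2)
    (2 * a * α * Real.cos θ ^ 2 / D - S * (2 * a * α - 2 * r * M) / D ^ 2)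
    (2 * a * α * Real.cos θ ^ 2)

/-- `∂_r h_{μν}`. -/
def varMetricDr (m a M α r θ : ℝ) : Matrix (Fin 4) (Fin 4) ℝ :=
  let s := Real.sin θ
  let S := rhoSq a r θ
  let D := horizonPoly m a r
  let f' := 2 * m / S - 4 * m * r ^ 2 / S ^ 2
  circular (varFDr m a M α r θ) (-((varFDr m a M α r θ * a + f' * α) * s ^ 2))
    ((varFDr m a M α r θ * a ^ 2 * s ^ 2 + f' * (2 * a * α) * s ^ 2) * s ^ 2)
    (-(2 * a * α * Real.cos θ ^ 2 * (2 * r - 2 * m)) / D ^ 2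
      - (2 * r * (2 * a * α - 2 * r * M) - 2 * M * S) / D ^ 2
      + 2 * S * (2 * a * α - 2 * r * M) * (2 * r - 2 * m) / D ^ 3)
    0

section Deriv

variable {m a r θ : ℝ}

lemma hasDerivAt_metric_m (hD : horizonPoly m a r ≠ 0) (μ ν : Fin 4) :
    HasDerivAt (fun m => circular (gtt m a r θ) (gtp m a r θ) (gpp m a r θ) (grr m a r θ)
      (rhoSq a r θ) μ ν) (varMetric m a 1 0 r θ μ ν) m := by
  fin_cases μ <;> fin_cases ν <;>
    simp only [circular, varMetric, varF, Matrix.of_apply, Matrix.cons_val', Matrix.cons_val,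
      Fin.reduceFinMk, Fin.zero_eta, Fin.mk_one, Fin.isValue, gtt, gtp, gpp, grr,
      Matrix.cons_val_zero, Matrix.cons_val_one] <;>
    refine HasDerivAt.congr_deriv (by
      repeat' with_reducible first
        | exact hD
        | exact hasDerivAt_const _ _
        | exact hasDerivAt_horizonPoly_m _ _ _
        | exact hasDerivAt_id' _
        | apply HasDerivAt.fun_neg
        | apply HasDerivAt.fun_sub
        | apply HasDerivAt.fun_add
        | apply HasDerivAt.div_const
        | apply HasDerivAt.fun_div
        | apply HasDerivAt.fun_pow
        | apply HasDerivAt.fun_mul) ?_ <;> ring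

lemma hasDerivAt_metric_a (hS : rhoSq a r θ ≠ 0) (hD : horizonPoly m a r ≠ 0) (μ ν : Fin 4) :
    HasDerivAt (fun a => circular (gtt m a r θ) (gtp m a r θ) (gpp m a r θ) (grr m a r θ)
      (rhoSq a r θ) μ ν) (varMetric m a 0 1 r θ μ ν) a := by
  fin_cases μ <;> fin_cases ν <;>
    simp only [circular, varMetric, varF, Matrix.of_apply, Matrix.cons_val', Matrix.cons_val,
      Fin.reduceFinMk, Fin.zero_eta, Fin.mk_one, Fin.isValue, gtt, gtp, gpp, grr,
      Matrix.cons_val_zero, Matrix.cons_val_one] <;>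
    refine HasDerivAt.congr_deriv (by
      repeat' with_reducible first
        | exact hS
        | exact hD
        | exact hasDerivAt_const _ _
        | exact hasDerivAt_horizonPoly_a _ _ _
        | exact hasDerivAt_rhoSq_a _ _ _
        | exact hasDerivAt_id' _
        | apply HasDerivAt.fun_neg
        | apply HasDerivAt.fun_sub
        | apply HasDerivAt.fun_add
        | apply HasDerivAt.fun_div
        | apply HasDerivAt.fun_pow
        | apply HasDerivAt.fun_mul) ?_ <;> field_simp <;> ring

lemma varMetric_linear (m a M α r θ : ℝ) (μ ν : Fin 4) :
    varMetric m a M α r θ μ ν = varMetric m a 1 0 r θ μ ν * M + varMetric m a 0 1 r θ μ ν * α := by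
  fin_cases μ <;> fin_cases ν <;>
    simp only [circular, varMetric, varF, Matrix.of_apply, Matrix.cons_val', Matrix.cons_val,
      Fin.reduceFinMk, Fin.zero_eta, Fin.mk_one, Fin.isValue,
      Matrix.cons_val_zero, Matrix.cons_val_one] <;> ring

lemma hasDerivAt_varMetric_r (hS : rhoSq a r θ ≠ 0) (hD : horizonPoly m a r ≠ 0) (M α : ℝ)
    (μ ν : Fin 4) :
    HasDerivAt (fun r => varMetric m a M α r θ μ ν) (varMetricDr m a M α r θ μ ν) r := by
  have hS2 := pow_ne_zero 2 hS
  have hD2 := pow_ne_zero 2 hD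
  fin_cases μ <;> fin_cases ν <;>
    simp only [circular, varMetric, varMetricDr, varF, varFDr, Matrix.of_apply, Matrix.cons_val',
      Matrix.cons_val, Fin.reduceFinMk, Fin.zero_eta, Fin.mk_one, Fin.isValue,
      Matrix.cons_val_zero, Matrix.cons_val_one] <;>
    refine HasDerivAt.congr_deriv (by
      repeat' with_reducible first
        | exact hS
        | exact hD
        | exact hS2
        | exact hD2
        | exact hasDerivAt_const _ _
        | exact hasDerivAt_horizonPoly_r _ _ _
        | exact hasDerivAt_rhoSq_r _ _ _
        | exact hasDerivAt_id' _
        | apply HasDerivAt.fun_neg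
        | apply HasDerivAt.fun_sub
        | apply HasDerivAt.fun_add
        | apply HasDerivAt.fun_div
        | apply HasDerivAt.fun_pow
        | apply HasDerivAt.fun_mul) ?_ <;> field_simp <;> ring

end Deriv

section Variation

variable {p : Params} {x : Point}

lemma kerrVariation_metric (hp : p ∈ blackHoles) (hx : x ∈ exterior p) (δp : Params) :
    (kerrVariation p δp).metric x = varMetric (p 0) (p 1) (δp 0) (δp 1) (x 1) (x 2) := by
  obtain ⟨hS, hD, hs⟩ := exterior_pos hp hx
  ext μ ν
  have h0 : pd 0 (fun q => (kerr q).metric x μ ν) p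
      = varMetric (p 0) (p 1) 1 0 (x 1) (x 2) μ ν := by
    have := (hasDerivAt_metric_m (θ := x 2) hD.ne' μ ν).deriv
    simpa [pd, kerr, kerrMetric_eq] using this
  have h1 : pd 1 (fun q => (kerr q).metric x μ ν) p
      = varMetric (p 0) (p 1) 0 1 (x 1) (x 2) μ ν := by
    have := (hasDerivAt_metric_a hS.ne' hD.ne' μ ν).deriv
    simpa [pd, kerr, kerrMetric_eq] using this
  have h2 : pd 2 (fun q => (kerr q).metric x μ ν) p = 0 := by
    simp [pd, kerr, kerrMetric_eq]
  rw [varMetric_linear]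
  simp [kerrVariation, Fin.sum_univ_three, h0, h1, h2]

lemma kerrVariation_dilaton (p δp : Params) (x : Point) :
    (kerrVariation p δp).dilaton x = δp 2 := by
  simp [kerrVariation, kerr, Fin.sum_univ_three, pd]

lemma pd_kerrVariation_r (hp : p ∈ blackHoles) (hx : x ∈ exterior p) (δp : Params) (μ ν : Fin 4) :
    pd 1 (fun y => (kerrVariation p δp).metric y μ ν) x
      = varMetricDr (p 0) (p 1) (δp 0) (δp 1) (x 1) (x 2) μ ν := by
  obtain ⟨hS, hD, hs⟩ := exterior_pos hp hx
  rw [pd_congr (isOpen_exterior p) (fun y hy => by rw [kerrVariation_metric hp hy]) hx 1]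
  exact pd_r (F := fun r θ => varMetric (p 0) (p 1) (δp 0) (δp 1) r θ μ ν)
    (hasDerivAt_varMetric_r hS.ne' hD.ne' _ _ μ ν)

lemma pd_kerrVariation_t (hp : p ∈ blackHoles) (hx : x ∈ exterior p) (δp : Params) (μ ν : Fin 4) :
    pd 0 (fun y => (kerrVariation p δp).metric y μ ν) x = 0 := by
  rw [pd_congr (isOpen_exterior p) (fun y hy => by rw [kerrVariation_metric hp hy]) hx 0]
  exact pd_t (fun r θ => varMetric (p 0) (p 1) (δp 0) (δp 1) r θ μ ν) x

lemma pd_kerrVariation_phi (hp : p ∈ blackHoles) (hx : x ∈ exterior p) (δp : Params)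
    (μ ν : Fin 4) : pd 3 (fun y => (kerrVariation p δp).metric y μ ν) x = 0 := by
  rw [pd_congr (isOpen_exterior p) (fun y hy => by rw [kerrVariation_metric hp hy]) hx 3]
  exact pd_phi (fun r θ => varMetric (p 0) (p 1) (δp 0) (δp 1) r θ μ ν) x

/-- This is the only θ derivative of h_{μν} needed for Θ^r. The divergence term brings in ∂_θ
h_{rθ}, and the trace term contains only ∂_r. -/
lemma pd_kerrVariation_theta_rtheta (hp : p ∈ blackHoles) (hx : x ∈ exterior p) (δp : Params) :
    pd 2 (fun y => (kerrVariation p δp).metric y 1 2) x = 0 := by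
  rw [pd_congr (isOpen_exterior p) (g := fun _ => 0)
    (fun y hy => by rw [kerrVariation_metric hp hy]; rfl) hx 2]
  exact pd_const _ _ _

end Variation

/-- The radial component of the symplectic potential, for the closed forms above. -/
lemma theta_algebra {m a r θ : ℝ} (hS : rhoSq a r θ ≠ 0) (hD : horizonPoly m a r ≠ 0)
    (hs : Real.sin θ ≠ 0) (M α : ℝ) (dh : Fin 4 → Matrix (Fin 4) (Fin 4) ℝ)
    (h0 : dh 0 = 0) (h1 : dh 1 = varMetricDr m a M α r θ) (h2 : dh 2 1 2 = 0) (h3 : dh 3 = 0)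
    (cov : Fin 4 → Fin 4 → Fin 4 → ℝ)
    (hcov : ∀ κ μ ν, cov κ μ ν = dh κ μ ν
      - ∑ l, (kerrGamma m a r θ l κ μ * varMetric m a M α r θ l ν
      + kerrGamma m a r θ l κ ν * varMetric m a M α r θ μ l)) :
    ∑ μ, ∑ ν, ∑ κ, kerrInverse m a r θ 1 μ * kerrInverse m a r θ ν κ * (cov κ μ ν - cov μ ν κ)
      = (2 * M + 2 * a * α * (r - m) * (3 * r ^ 2 * Real.cos θ ^ 2 - r ^ 2
          + a ^ 2 * Real.cos θ ^ 4 + a ^ 2 * Real.cos θ ^ 2) / rhoSq a r θ ^ 2)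
        / rhoSq a r θ := by
  have eS : rhoSq a r θ = r ^ 2 + a ^ 2 * Real.cos θ ^ 2 := rfl
  have eD : horizonPoly m a r = r ^ 2 + a ^ 2 - 2 * m * r := rfl
  have e2 := Real.sin_sq θ
  have e4 : Real.sin θ ^ 4 = (1 - Real.cos θ ^ 2) ^ 2 := by rw [← e2]; ring
  simp only [Fin.sum_univ_four, kerrInverse, circular, Matrix.of_apply, Matrix.cons_val',
    Matrix.cons_val, Fin.isValue, Matrix.cons_val_zero, Matrix.cons_val_one, mul_zero, zero_mul,
    add_zero, zero_add]
  simp only [hcov, h0, h1, h2, h3, Matrix.zero_apply, varMetricDr, varMetric, kerrGamma,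
    Fin.sum_univ_four, circular, Matrix.of_apply, Matrix.cons_val',
    Matrix.cons_val, Fin.isValue, Matrix.cons_val_zero, Matrix.cons_val_one, mul_zero,
    add_zero, zero_add, zero_sub, sub_self, varF, varFDr]
  -- The identity is rational in independent s, c, S, D, and holds modulo the definitions of ρ² and
  -- Δ and sin² = 1 - cos².
  generalize Real.sin θ = s at *
  generalize Real.cos θ = c at *
  generalize rhoSq a r θ = S at *
  generalize horizonPoly m a r = D at *
  field_simp
  rw [eS, eD]
  ring_nf
  simp only [e2, e4]
  ring1

/-! ### The charge density on a coordinate sphere -/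

/-- For constant e^{-φ} the gradient terms drop. The block inverse leaves F g^{rr} (g^{tt} ∂_r ξ_t +
g^{tϕ} ∂_r ξ_ϕ). -/
lemma noetherPotential_circular {Φ : Fields} {x : Point} {A B C D E F X0 X3 : ℝ} (G : ℝ)
    {ξ : Point → Fin 4 → ℝ} (hm : Φ.metric x = circular A B C D E) (hD : D ≠ 0) (hE : E ≠ 0)
    (hX : A * C - B ^ 2 ≠ 0) (hF : Φ.coupling = fun _ => F)
    (h10 : pd 1 (fun y => Φ.flat ξ y 0) x = X0) (h13 : pd 1 (fun y => Φ.flat ξ y 3) x = X3)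
    (h01 : pd 0 (fun y => Φ.flat ξ y 1) x = 0) (h31 : pd 3 (fun y => Φ.flat ξ y 1) x = 0) :
    Φ.noetherPotential x G ξ 0 1
      = 1 / (16 * Real.pi * G) * (F * (D⁻¹ * ((C * X0 - B * X3) / (A * C - B ^ 2)))) := by
  have hi : Φ.inv x = circular (C / (A * C - B ^ 2)) (-B / (A * C - B ^ 2))
      (A / (A * C - B ^ 2)) D⁻¹ E⁻¹ := by rw [Fields.inv, hm, inv_circular hD hE hX]
  have hg : ∀ μ, Φ.grad x Φ.coupling μ = 0 := fun μ => by simp [Fields.grad, hF]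
  unfold Fields.noetherPotential
  rw [hg, hg, hi, hF]
  simp only [Fin.sum_univ_four, circular, Matrix.of_apply, Matrix.cons_val', Matrix.cons_val,
    Fin.isValue, Matrix.cons_val_zero, Matrix.cons_val_one, h10, h13, h01, h31, mul_zero, zero_mul,
    add_zero, zero_add, sub_zero]
  ring

/-- If `E / (D X)` is stationary at `0`, so is `√|D E X| / (D X)`. -/
lemma hasDerivAt_vol_mul {F D E X W : ℝ → ℝ} {F' D' E' X' W' : ℝ} (k : ℝ)
    (hF : HasDerivAt F F' 0) (hD : HasDerivAt D D' 0) (hE : HasDerivAt E E' 0)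
    (hX : HasDerivAt X X' 0) (hW : HasDerivAt W W' 0) (hD0 : 0 < D 0) (hE0 : 0 < E 0)
    (hX0 : X 0 < 0) (h : D 0 * X 0 * E' = E 0 * (D' * X 0 + D 0 * X')) :
    HasDerivAt (fun s => Real.sqrt |D s * E s * X s| * (k * (F s * ((D s)⁻¹ * (W s / X s)))))
      (Real.sqrt |D 0 * E 0 * X 0| * (k * ((D 0)⁻¹ * ((F' * W 0 + F 0 * W') / X 0)))) 0 := by
  have hd : D 0 * E 0 * X 0 < 0 := mul_neg_of_pos_of_neg (mul_pos hD0 hE0) hX0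
  have habs : 0 < |D 0 * E 0 * X 0| := abs_pos.2 hd.ne
  have hQ := (Real.sqrt_pos.2 habs).ne'
  have hQ2 : Real.sqrt |D 0 * E 0 * X 0| ^ 2 = -(D 0 * E 0 * X 0) := by
    rw [Real.sq_sqrt habs.le, abs_of_neg hd]
  have hsq : HasDerivAt (fun s => Real.sqrt |D s * E s * X s|)
      (-1 * ((D' * E 0 + D 0 * E') * X 0 + D 0 * E 0 * X') / (2 * Real.sqrt |D 0 * E 0 * X 0|)) 0 :=
    HasDerivAt.sqrt (f := fun s => |D s * E s * X s|)
      (HasDerivAt.comp (h₂ := fun y => |y|) (0 : ℝ) (hasDerivAt_abs_neg hd)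
        ((hD.fun_mul hE).fun_mul hX)) habs.ne'
  -- By `h`, E and D X have the same logarithmic derivative, so √|D E X| shares it too and the
  -- prefactor √|D E X| / (D X) does not vary. Only F and W contribute.
  have hsq' : HasDerivAt (fun s => Real.sqrt |D s * E s * X s|)
      (Real.sqrt |D 0 * E 0 * X 0| * (D' * X 0 + D 0 * X') / (D 0 * X 0)) 0 := by
    refine hsq.congr_deriv ?_
    have h1 := hD0.ne'
    have h2 := hX0.ne
    generalize Real.sqrt |D 0 * E 0 * X 0| = Q at *
    field_simp
    rw [hQ2]
    linear_combination -(D 0 * X 0) * h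
  have hD1 := hD0.ne'
  have hX1 := hX0.ne
  refine (hsq'.fun_mul ((hF.fun_mul ((hD.fun_inv hD1).fun_mul
    (hW.fun_div hX hX1))).const_mul k)).congr_deriv ?_
  field_simp
  ring

/-- `√(-g) Q_ξ^{tr}` for `ξ = u ∂_t + w ∂_ϕ`, in units of `e^{-φ} / (16πG)`. -/
def komarDensity (m a u w r θ : ℝ) : ℝ :=
  let s := Real.sin θ
  let c := Real.cos θ
  2 * m * s * (u * (r ^ 2 + a ^ 2) * (r ^ 2 - a ^ 2 * c ^ 2)
    - w * a * s ^ 2 * (3 * r ^ 4 + r ^ 2 * a ^ 2 * (1 + c ^ 2) - a ^ 4 * c ^ 2)) / rhoSq a r θ ^ 2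

/-- The variation of `komarDensity` under `(δm, δa)`. -/
def komarVariation (m a M α u w r θ : ℝ) : ℝ :=
  let s := Real.sin θ
  let c := Real.cos θ
  2 * s * (u * (M * (r ^ 2 + a ^ 2) * (r ^ 4 - a ^ 4 * c ^ 4)
      + 2 * m * a * α * r ^ 2 * (r ^ 2 - 3 * r ^ 2 * c ^ 2 + a ^ 2 * c ^ 4 - 3 * a ^ 2 * c ^ 2))
    - w * s ^ 2 * (M * a * (3 * r ^ 6 + r ^ 4 * a ^ 2 * (4 * c ^ 2 + 1) + r ^ 2 * a ^ 4 * c ^ 4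
        - a ^ 6 * c ^ 4)
      + m * α * (3 * r ^ 6 + r ^ 4 * a ^ 2 * (3 - 6 * c ^ 2) - r ^ 2 * a ^ 4 * (c ^ 4 + 6 * c ^ 2)
        - a ^ 6 * c ^ 4))) / rhoSq a r θ ^ 3

/-- `√(-g) Θ^r` in units of `e^{-φ} / (16πG)`. -/
def thetaDensity (m a M α r θ : ℝ) : ℝ :=
  let c := Real.cos θ
  Real.sin θ * (2 * M + 2 * a * α * (r - m) * (3 * r ^ 2 * c ^ 2 - r ^ 2
    + a ^ 2 * c ^ 4 + a ^ 2 * c ^ 2) / rhoSq a r θ ^ 2)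

section Algebra

variable {m a r θ : ℝ}

/-- The factor √(-g) g^{rr} divided by the (t, ϕ) determinant is -1 / sin θ, whence the sign and the
sine on the right. -/
lemma komarDensity_eq (hS : rhoSq a r θ ≠ 0) (u w : ℝ) :
    gpp m a r θ * (kerrMetricDr m a r θ 0 0 * u + kerrMetricDr m a r θ 0 3 * w)
      - gtp m a r θ * (kerrMetricDr m a r θ 3 0 * u + kerrMetricDr m a r θ 3 3 * w)
      = -(Real.sin θ * komarDensity m a u w r θ) := by
  have eS : rhoSq a r θ = r ^ 2 + a ^ 2 * Real.cos θ ^ 2 := rfl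
  simp only [kerrMetricDr, circular, Matrix.of_apply, Matrix.cons_val', Matrix.cons_val,
    Fin.isValue, Matrix.cons_val_zero, gpp, gtp, komarDensity]
  generalize Real.sin θ = s at *
  generalize Real.cos θ = c at *
  generalize rhoSq a r θ = S at *
  field_simp
  rw [eS]
  ring

lemma komarVariation_eq (hS : rhoSq a r θ ≠ 0) (M α u w : ℝ) :
    varMetric m a M α r θ 3 3 * (kerrMetricDr m a r θ 0 0 * u + kerrMetricDr m a r θ 0 3 * w)
      + gpp m a r θ * (varMetricDr m a M α r θ 0 0 * u + varMetricDr m a M α r θ 0 3 * w)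
      - (varMetric m a M α r θ 0 3 * (kerrMetricDr m a r θ 3 0 * u + kerrMetricDr m a r θ 3 3 * w)
      + gtp m a r θ * (varMetricDr m a M α r θ 3 0 * u + varMetricDr m a M α r θ 3 3 * w))
      = -(Real.sin θ * komarVariation m a M α u w r θ) := by
  have eS : rhoSq a r θ = r ^ 2 + a ^ 2 * Real.cos θ ^ 2 := rfl
  simp only [kerrMetricDr, varMetric, varMetricDr, varF, varFDr, circular, Matrix.of_apply,
    Matrix.cons_val', Matrix.cons_val, Fin.isValue, Matrix.cons_val_zero, gpp, gtp, komarVariation]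
  generalize Real.sin θ = s at *
  generalize Real.cos θ = c at *
  generalize rhoSq a r θ = S at *
  field_simp
  rw [eS]
  ring

/-- Variation of the determinant `-Δ sin² θ` of the `(t, ϕ)` block. -/
lemma varMetric_block (hS : rhoSq a r θ ≠ 0) (M α : ℝ) :
    varMetric m a M α r θ 0 0 * gpp m a r θ + gtt m a r θ * varMetric m a M α r θ 3 3
      - 2 * gtp m a r θ * varMetric m a M α r θ 0 3
      = -((2 * a * α - 2 * r * M) * Real.sin θ ^ 2) := by
  have eS : rhoSq a r θ = r ^ 2 + a ^ 2 * Real.cos θ ^ 2 := rfl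
  have e2 := Real.sin_sq θ
  have e4 : Real.sin θ ^ 4 = (1 - Real.cos θ ^ 2) ^ 2 := by rw [← e2]; ring
  simp only [varMetric, varF, circular, Matrix.of_apply,
    Matrix.cons_val', Matrix.cons_val, Fin.isValue, Matrix.cons_val_zero, gpp, gtp, gtt]
  generalize Real.sin θ = s at *
  generalize Real.cos θ = c at *
  generalize rhoSq a r θ = S at *
  field_simp
  rw [eS]
  ring_nf
  simp only [e2, e4]
  ring1

end Algebra

/-! ### Symplectic potential and charge density of Kerr -/

section Kerr

variable {p : Params} {x : Point}

/-- The term with δφ is multiplied by ∂φ = 0, so Θ^r does not see δφ_∞. This is the source of the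
mismatch in the mass variation. -/
lemma theta_kerr (hp : p ∈ blackHoles) (hx : x ∈ exterior p) (δp : Params) (G : ℝ) :
    (kerr p).theta (kerrVariation p δp) x G 1 = 1 / (16 * Real.pi * G) * (Real.exp (-p 2) *
      ((2 * δp 0 + 2 * p 1 * δp 1 * (x 1 - p 0) * (3 * x 1 ^ 2 * Real.cos (x 2) ^ 2 - x 1 ^ 2
          + p 1 ^ 2 * Real.cos (x 2) ^ 4 + p 1 ^ 2 * Real.cos (x 2) ^ 2)
          / rhoSq (p 1) (x 1) (x 2) ^ 2) / rhoSq (p 1) (x 1) (x 2))) := by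
  obtain ⟨hS, hD, hs⟩ := exterior_pos hp hx
  have hdil : (kerr p).dilaton = fun _ => p 2 := rfl
  have hcpl : (kerr p).coupling = fun _ => Real.exp (-p 2) := rfl
  have hg : ∀ (k : ℝ) μ, (kerr p).grad x (fun _ => k) μ = 0 := fun k μ => by simp [Fields.grad]
  have key := theta_algebra hS.ne' hD.ne' hs.ne' (δp 0) (δp 1)
    (fun l => Matrix.of fun μ ν => pd l (fun y => (kerrVariation p δp).metric y μ ν) x)
    (by ext μ ν; exact pd_kerrVariation_t hp hx δp μ ν)
    (by ext μ ν; exact pd_kerrVariation_r hp hx δp μ ν)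
    (pd_kerrVariation_theta_rtheta hp hx δp)
    (by ext μ ν; exact pd_kerrVariation_phi hp hx δp μ ν)
    ((kerr p).covDerivPert (kerrVariation p δp) x) (fun κ μ ν => by
      simp only [Fields.covDerivPert, christoffel_kerr hp hx, kerrVariation_metric hp hx,
        Matrix.of_apply])
  unfold Fields.theta
  rw [hcpl, hdil]
  simp only [hg, kerr_inv hp hx, key, mul_zero, Finset.sum_const_zero, sub_zero, add_zero]

/-- Derivatives of the components of the lowered generator in the perturbed metric. -/
lemma pd_flat_perturb (hp : p ∈ blackHoles) (hx : x ∈ exterior p) (δp : Params) (u w s : ℝ)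
    (β : Fin 4) :
    pd 1 (fun y => ((kerr p).perturb (kerrVariation p δp) s).flat (stationaryAxial u w) y β) x
      = (kerrMetricDr (p 0) (p 1) (x 1) (x 2) β 0
          + s * varMetricDr (p 0) (p 1) (δp 0) (δp 1) (x 1) (x 2) β 0) * u
        + (kerrMetricDr (p 0) (p 1) (x 1) (x 2) β 3
          + s * varMetricDr (p 0) (p 1) (δp 0) (δp 1) (x 1) (x 2) β 3) * w ∧
    pd 0 (fun y => ((kerr p).perturb (kerrVariation p δp) s).flat (stationaryAxial u w) y β) x = 0 ∧
    pd 3 (fun y => ((kerr p).perturb (kerrVariation p δp) s).flat (stationaryAxial u w) y β) x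
      = 0 := by
  obtain ⟨hS, hD, hs⟩ := exterior_pos hp hx
  let g : Fin 4 → ℝ → ℝ → ℝ := fun l r θ => circular (gtt (p 0) (p 1) r θ) (gtp (p 0) (p 1) r θ)
    (gpp (p 0) (p 1) r θ) (grr (p 0) (p 1) r θ) (rhoSq (p 1) r θ) β l
      + s * varMetric (p 0) (p 1) (δp 0) (δp 1) r θ β l
  let F : ℝ → ℝ → ℝ := fun r θ => g 0 r θ * u + g 3 r θ * w
  have hF : EqOn (fun y => ((kerr p).perturb (kerrVariation p δp) s).flat (stationaryAxial u w) y β)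
      (fun y => F (y 1) (y 2)) (exterior p) := fun y hy => by
    simp [Fields.flat, Fields.perturb, kerrVariation_metric hp hy, stationaryAxial,
      Fin.sum_univ_four, F, g, kerr, kerrMetric_eq]
  have hg : ∀ l, HasDerivAt (fun r => g l r (x 2)) (kerrMetricDr (p 0) (p 1) (x 1) (x 2) β l
      + s * varMetricDr (p 0) (p 1) (δp 0) (δp 1) (x 1) (x 2) β l) (x 1) := fun l =>
    (hasDerivAt_metric_r hS.ne' hD.ne' β l).fun_add
      ((hasDerivAt_varMetric_r hS.ne' hD.ne' _ _ β l).const_mul s)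
  refine ⟨?_, ?_, ?_⟩ <;> rw [pd_congr (isOpen_exterior p) hF hx]
  · exact pd_r (F := F) (((hg 0).mul_const u).fun_add ((hg 3).mul_const w))
  · exact pd_t F x
  · exact pd_phi F x

lemma chargeDensity_kerr (hp : p ∈ blackHoles) (hx : x ∈ exterior p) (δp : Params) (G u w : ℝ) :
    (kerr p).chargeDensity (kerrVariation p δp) x G (stationaryAxial u w) 0 1
      = 1 / (16 * Real.pi * G) * Real.exp (-p 2) *
        (komarVariation (p 0) (p 1) (δp 0) (δp 1) u w (x 1) (x 2)
          - δp 2 * komarDensity (p 0) (p 1) u w (x 1) (x 2)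
          + u * thetaDensity (p 0) (p 1) (δp 0) (δp 1) (x 1) (x 2)) := by
  obtain ⟨hS, hD, hs⟩ := exterior_pos hp hx
  have hΘ := theta_kerr hp hx δp G
  set m := p 0
  set a := p 1
  set r := x 1
  set θ := x 2
  let h : Matrix (Fin 4) (Fin 4) ℝ := varMetric m a (δp 0) (δp 1) r θ
  let g' : Matrix (Fin 4) (Fin 4) ℝ := kerrMetricDr m a r θ
  let h' : Matrix (Fin 4) (Fin 4) ℝ := varMetricDr m a (δp 0) (δp 1) r θ
  let A : ℝ → ℝ := fun s => gtt m a r θ + s * h 0 0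
  let B : ℝ → ℝ := fun s => gtp m a r θ + s * h 0 3
  let C : ℝ → ℝ := fun s => gpp m a r θ + s * h 3 3
  let D : ℝ → ℝ := fun s => grr m a r θ + s * h 1 1
  let E : ℝ → ℝ := fun s => rhoSq a r θ + s * h 2 2
  let F : ℝ → ℝ := fun s => Real.exp (-(p 2 + s * δp 2))
  let X : ℝ → ℝ := fun s => A s * C s - B s ^ 2
  let W : ℝ → ℝ := fun s =>
    C s * ((g' 0 0 + s * h' 0 0) * u + (g' 0 3 + s * h' 0 3) * w)
      - B s * ((g' 3 0 + s * h' 3 0) * u + (g' 3 3 + s * h' 3 3) * w)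
  have lin : ∀ b k : ℝ, HasDerivAt (fun s : ℝ => b + s * k) k 0 := fun b k => by
    simpa using ((hasDerivAt_id' (0 : ℝ)).mul_const k).const_add b
  have hA : HasDerivAt A (h 0 0) 0 := lin _ _
  have hB : HasDerivAt B (h 0 3) 0 := lin _ _
  have hC : HasDerivAt C (h 3 3) 0 := lin _ _
  have hD' : HasDerivAt D (h 1 1) 0 := lin _ _
  have hE : HasDerivAt E (h 2 2) 0 := lin _ _
  have hF : HasDerivAt F (-δp 2 * Real.exp (-p 2)) 0 := by
    refine (lin (p 2) (δp 2)).fun_neg.exp.congr_deriv ?_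
    simp [mul_comm]
  have hX0 : X 0 = -(horizonPoly m a r * Real.sin θ ^ 2) := by
    simp only [X, A, B, C, zero_mul, add_zero]
    exact gtt_mul_gpp_sub m a hS.ne'
  have hX : HasDerivAt X (-((2 * a * δp 1 - 2 * r * δp 0) * Real.sin θ ^ 2)) 0 := by
    refine ((hA.fun_mul hC).fun_sub (hB.fun_pow 2)).congr_deriv ?_
    rw [← varMetric_block (m := m) hS.ne' (δp 0) (δp 1)]
    simp [A, B, C, h]
  have hW0 : W 0 = -(Real.sin θ * komarDensity m a u w r θ) := by
    rw [← komarDensity_eq hS.ne']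
    simp only [W, B, C, zero_mul, add_zero, g']
  have hW : HasDerivAt W (-(Real.sin θ * komarVariation m a (δp 0) (δp 1) u w r θ)) 0 := by
    have hX0 := ((lin (g' 0 0) (h' 0 0)).mul_const u).fun_add ((lin (g' 0 3) (h' 0 3)).mul_const w)
    have hX3 := ((lin (g' 3 0) (h' 3 0)).mul_const u).fun_add ((lin (g' 3 3) (h' 3 3)).mul_const w)
    refine ((hC.fun_mul hX0).fun_sub (hB.fun_mul hX3)).congr_deriv ?_
    rw [← komarVariation_eq hS.ne']
    simp only [B, C, h, g', h', zero_mul, add_zero]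
  have hD0 : D 0 = rhoSq a r θ / horizonPoly m a r := by simp [D, grr]
  have hE0 : E 0 = rhoSq a r θ := by simp [E]
  have hF0 : F 0 = Real.exp (-p 2) := by simp [F]
  have hX0neg : X 0 < 0 := by rw [hX0]; exact neg_neg_of_pos (by positivity)
  have hD0pos : 0 < D 0 := by rw [hD0]; positivity
  have hE0pos : 0 < E 0 := by rw [hE0]; exact hS
  have hS' := hS.ne'
  have hΔ' := hD.ne'
  have hs' := hs.ne'
  -- For Kerr E / (D X) = -1 / sin² θ for all parameters, so its variation vanishes.
  have hstat : D 0 * X 0 * h 2 2 = E 0 * (h 1 1 * X 0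
      + D 0 * -((2 * a * δp 1 - 2 * r * δp 0) * Real.sin θ ^ 2)) := by
    rw [hD0, hE0, hX0]
    simp only [h, varMetric, circular, Matrix.of_apply, Matrix.cons_val', Matrix.cons_val,
      Fin.isValue, Matrix.cons_val_one]
    field_simp
    ring
  have hvol := hasDerivAt_vol_mul (1 / (16 * Real.pi * G)) hF hD' hE hX hW
    hD0pos hE0pos hX0neg hstat
  have hmetric : ∀ s, ((kerr p).perturb (kerrVariation p δp) s).metric x
      = circular (A s) (B s) (C s) (D s) (E s) := fun s => by
    simp only [Fields.perturb, kerrVariation_metric hp hx]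
    ext i j
    fin_cases i <;> fin_cases j <;>
      simp [kerr, kerrMetric_eq, circular, A, B, C, D, E, h, varMetric] <;> rfl
  have hcoupl : ∀ s, ((kerr p).perturb (kerrVariation p δp) s).coupling = fun _ => F s :=
      fun s => by
    funext y
    simp [Fields.coupling, Fields.perturb, kerrVariation_dilaton, kerr, F]
  -- The perturbed metric keeps the circular block form for every s. It is invertible for small s,
  -- which is enough for the derivative at 0.
  have hev : (fun s => ((kerr p).perturb (kerrVariation p δp) s).vol x
      * ((kerr p).perturb (kerrVariation p δp) s).noetherPotential x G (stationaryAxial u w) 0 1)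
      =ᶠ[𝓝 0] fun s => Real.sqrt |D s * E s * X s|
        * (1 / (16 * Real.pi * G) * (F s * ((D s)⁻¹ * (W s / X s)))) := by
    filter_upwards [hD'.continuousAt.eventually_ne hD0pos.ne',
      hE.continuousAt.eventually_ne hE0pos.ne', hX.continuousAt.eventually_ne hX0neg.ne]
      with s h1 h2 h3
    rw [noetherPotential_circular G (hmetric s) h1 h2 h3 (hcoupl s)
      (pd_flat_perturb hp hx δp u w s 0).1 (pd_flat_perturb hp hx δp u w s 3).1
      (pd_flat_perturb hp hx δp u w s 1).2.1 (pd_flat_perturb hp hx δp u w s 1).2.2,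
      Fields.vol, hmetric s, det_circular]
  have hsqrt : Real.sqrt |D 0 * E 0 * X 0| = rhoSq a r θ * Real.sin θ := by
    rw [show D 0 * E 0 * X 0 = -(rhoSq a r θ * Real.sin θ) ^ 2 by
      rw [hD0, hE0, hX0]; field_simp, abs_neg, abs_of_nonneg (sq_nonneg _),
      Real.sqrt_sq (by positivity)]
  have hvol0 : (kerr p).vol x = rhoSq a r θ * Real.sin θ := by
    have := hmetric 0
    simp only [Fields.perturb, zero_smul, add_zero] at this
    rw [Fields.vol, this, det_circular, ← hsqrt]
  unfold Fields.chargeDensity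
  rw [hev.deriv_eq, hvol.deriv, hsqrt, hvol0, hΘ, hW0, hX0, hD0, hF0]
  simp only [stationaryAxial, Matrix.cons_val_zero, Matrix.cons_val_one, zero_mul, sub_zero,
    thetaDensity]
  generalize 1 / (16 * Real.pi * G) = k
  field_simp
  ring

end Kerr

/-! ### The parametric charge variations -/

/-- An antiderivative of `-komarDensity` with respect to `θ`. -/
def komarPrimitive (m a u w r θ : ℝ) : ℝ :=
  let c := Real.cos θ
  2 * m * c * (u * (r ^ 2 + a ^ 2)
    + w * a * (r ^ 2 * c ^ 2 - 3 * r ^ 2 - a ^ 2 * c ^ 2 - a ^ 2)) / rhoSq a r θ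

/-- An antiderivative of `-komarVariation` with respect to `θ`. -/
def komarVariationPrimitive (m a M α u w r θ : ℝ) : ℝ :=
  let c := Real.cos θ
  let y := r ^ 2 * c ^ 2 - 3 * r ^ 2 - a ^ 2 * c ^ 2 - a ^ 2
  2 * c * (u * (M * (r ^ 2 + a ^ 2) + 2 * m * a * α)
      + w * ((M * a + m * α) * y - 2 * m * a ^ 2 * α * (1 + c ^ 2))) / rhoSq a r θ
    - 4 * m * a * α * c ^ 3 * (u * (r ^ 2 + a ^ 2) + w * a * y) / rhoSq a r θ ^ 2

/-- An antiderivative of `-thetaDensity` with respect to `θ`. -/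
def thetaPrimitive (m a M α r θ : ℝ) : ℝ :=
  let c := Real.cos θ
  2 * M * c - 2 * a * α * (r - m) * c * (1 - c ^ 2) / rhoSq a r θ

section Primitive

variable {m a r θ : ℝ}

lemma hasDerivAt_komarPrimitive (hS : rhoSq a r θ ≠ 0) (u w : ℝ) :
    HasDerivAt (komarPrimitive m a u w r) (-komarDensity m a u w r θ) θ := by
  have eS : rhoSq a r θ = r ^ 2 + a ^ 2 * Real.cos θ ^ 2 := rfl
  have e2 := Real.sin_sq θ
  unfold komarPrimitive
  refine HasDerivAt.congr_deriv (by
      repeat' with_reducible first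
        | exact hS
        | exact hasDerivAt_const _ _
        | exact hasDerivAt_rhoSq_theta _ _ _
        | exact Real.hasDerivAt_cos _
        | apply HasDerivAt.fun_sub
        | apply HasDerivAt.fun_add
        | apply HasDerivAt.fun_div
        | apply HasDerivAt.fun_pow
        | apply HasDerivAt.fun_mul) ?_
  simp only [komarDensity]
  generalize Real.sin θ = s at *
  generalize Real.cos θ = c at *
  generalize rhoSq a r θ = S at *
  field_simp
  rw [e2, eS]
  ring

lemma hasDerivAt_komarVariationPrimitive (hS : rhoSq a r θ ≠ 0) (M α u w : ℝ) :
    HasDerivAt (komarVariationPrimitive m a M α u w r) (-komarVariation m a M α u w r θ) θ := by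
  have eS : rhoSq a r θ = r ^ 2 + a ^ 2 * Real.cos θ ^ 2 := rfl
  have e2 := Real.sin_sq θ
  have hS2 := pow_ne_zero 2 hS
  unfold komarVariationPrimitive
  refine HasDerivAt.congr_deriv (by
      repeat' with_reducible first
        | exact hS
        | exact hS2
        | exact hasDerivAt_const _ _
        | exact hasDerivAt_rhoSq_theta _ _ _
        | exact Real.hasDerivAt_cos _
        | apply HasDerivAt.fun_sub
        | apply HasDerivAt.fun_add
        | apply HasDerivAt.fun_div
        | apply HasDerivAt.fun_pow
        | apply HasDerivAt.fun_mul) ?_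
  simp only [komarVariation]
  generalize Real.sin θ = s at *
  generalize Real.cos θ = c at *
  generalize rhoSq a r θ = S at *
  field_simp
  rw [e2, eS]
  ring

lemma hasDerivAt_thetaPrimitive (hS : rhoSq a r θ ≠ 0) (M α : ℝ) :
    HasDerivAt (thetaPrimitive m a M α r) (-thetaDensity m a M α r θ) θ := by
  have eS : rhoSq a r θ = r ^ 2 + a ^ 2 * Real.cos θ ^ 2 := rfl
  unfold thetaPrimitive
  refine HasDerivAt.congr_deriv (by
      repeat' with_reducible first
        | exact hS
        | exact hasDerivAt_const _ _
        | exact hasDerivAt_rhoSq_theta _ _ _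
        | exact Real.hasDerivAt_cos _
        | apply HasDerivAt.fun_sub
        | apply HasDerivAt.fun_add
        | apply HasDerivAt.fun_div
        | apply HasDerivAt.fun_pow
        | apply HasDerivAt.fun_mul) ?_
  simp only [thetaDensity]
  generalize Real.sin θ = s at *
  generalize Real.cos θ = c at *
  generalize rhoSq a r θ = S at *
  field_simp
  rw [eS]
  ring

end Primitive

section Charges

variable {p : Params}

/-- The closed form of the charge density, as a function of `θ`. -/
def chargeProfile (p δp : Params) (u w r θ : ℝ) : ℝ :=
  komarVariation (p 0) (p 1) (δp 0) (δp 1) u w r θ - δp 2 * komarDensity (p 0) (p 1) u w r θ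
    + u * thetaDensity (p 0) (p 1) (δp 0) (δp 1) r θ

lemma continuous_chargeProfile (p δp : Params) (u w : ℝ) {r : ℝ} (hr : 0 < r) :
    Continuous (chargeProfile p δp u w r) := by
  have hS : ∀ θ, rhoSq (p 1) r θ ≠ 0 := fun θ => (rhoSq_pos (p 1) hr θ).ne'
  have hc : Continuous (rhoSq (p 1) r) := by unfold rhoSq; fun_prop
  change Continuous fun θ => chargeProfile p δp u w r θ
  simp only [chargeProfile, komarVariation, komarDensity, thetaDensity]
  fun_prop (disch := intro θ; exact pow_ne_zero _ (hS θ))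

/-- At cos θ = ±1 both ρ² and the polynomial multiplying w are multiples of r² + a², and the
a-dependent part of `thetaPrimitive` vanishes. Hence no r survives. For u the Komar and Θ terms each
give 4 δm. -/
lemma integral_chargeProfile (p δp : Params) (u w : ℝ) {r : ℝ} (hr : 0 < r) :
    ∫ θ in (0)..Real.pi, chargeProfile p δp u w r θ
      = 8 * (u * (δp 0 - p 0 / 2 * δp 2)
        - w * (p 1 * δp 0 + p 0 * δp 1 - p 0 * p 1 * δp 2)) := by
  have hS : ∀ θ, rhoSq (p 1) r θ ≠ 0 := fun θ => (rhoSq_pos (p 1) hr θ).ne'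
  have hderiv : ∀ θ ∈ uIcc 0 Real.pi, HasDerivAt (fun θ =>
      -(komarVariationPrimitive (p 0) (p 1) (δp 0) (δp 1) u w r θ
        - δp 2 * komarPrimitive (p 0) (p 1) u w r θ
        + u * thetaPrimitive (p 0) (p 1) (δp 0) (δp 1) r θ)) (chargeProfile p δp u w r θ) θ := by
    intro θ _
    refine (((hasDerivAt_komarVariationPrimitive (hS θ) (δp 0) (δp 1) u w).fun_sub
      ((hasDerivAt_komarPrimitive (hS θ) u w).const_mul (δp 2))).fun_add
      ((hasDerivAt_thetaPrimitive (hS θ) (δp 0) (δp 1)).const_mul u)).fun_neg.congr_deriv ?_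
    simp only [chargeProfile]
    ring
  rw [intervalIntegral.integral_eq_sub_of_hasDerivAt hderiv
    ((continuous_chargeProfile p δp u w hr).intervalIntegrable _ _)]
  have h1 : r ^ 2 + p 1 ^ 2 ≠ 0 := by positivity
  simp only [komarVariationPrimitive, komarPrimitive, thetaPrimitive, rhoSq, Real.cos_zero,
    Real.cos_pi]
  have h2 : r ^ 2 + p 1 ^ 2 * (-1) ^ 2 = r ^ 2 + p 1 ^ 2 := by ring
  have h3 : r ^ 2 + p 1 ^ 2 * 1 ^ 2 = r ^ 2 + p 1 ^ 2 := by ring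
  rw [h2, h3]
  field_simp
  ring

lemma sphereIntegrand_kerr (hp : p ∈ blackHoles) (δp : Params) (G u w t : ℝ) {r : ℝ}
    (hr : horizonRadius p < r) :
    EqOn (sphereIntegrand G (kerr p) (kerrVariation p δp) (stationaryAxial u w) t r)
      (fun q => 1 / (16 * Real.pi * G) * Real.exp (-p 2) * chargeProfile p δp u w r q.1) angles :=
  fun _ hq => chargeDensity_kerr hp ⟨hr, hq.1⟩ δp G u w

lemma integrableOn_sphereIntegrand (hp : p ∈ blackHoles) (δp : Params) (G u w t : ℝ) {r : ℝ}
    (hr : horizonRadius p < r) :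
    IntegrableOn (sphereIntegrand G (kerr p) (kerrVariation p δp) (stationaryAxial u w) t r)
      angles := by
  have hc := continuous_chargeProfile p δp u w ((horizonRadius_pos hp).trans hr)
  refine IntegrableOn.congr_fun (integrableOn_angles (f := fun θ =>
    1 / (16 * Real.pi * G) * Real.exp (-p 2) * chargeProfile p δp u w r θ) ?_)
    (sphereIntegrand_kerr hp δp G u w t hr).symm measurableSet_angles
  exact ((continuous_const.mul hc).integrableOn_Icc).mono_set Ioo_subset_Icc_self

theorem chargeVariation_kerr (hp : p ∈ blackHoles) (δp : Params) (G u w t : ℝ) {r : ℝ}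
    (hr : horizonRadius p < r) :
    chargeVariation G (kerr p) (kerrVariation p δp) (stationaryAxial u w) t r
      = Real.exp (-p 2) / G * (u * (δp 0 - p 0 / 2 * δp 2)
        - w * (p 1 * δp 0 + p 0 * δp 1 - p 0 * p 1 * δp 2)) := by
  unfold chargeVariation
  rw [setIntegral_congr_fun measurableSet_angles (sphereIntegrand_kerr hp δp G u w t hr),
    setIntegral_angles (fun θ => 1 / (16 * Real.pi * G) * Real.exp (-p 2)
      * chargeProfile p δp u w r θ), intervalIntegral.integral_const_mul,
    integral_chargeProfile p δp u w ((horizonRadius_pos hp).trans hr)]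
  field_simp
  ring

end Charges

/-! ### Differentials of the finite charges -/

lemma pd_of_hasFDerivAt {n : ℕ} {f : (Fin n → ℝ) → ℝ} {L : (Fin n → ℝ) →L[ℝ] ℝ} {p : Fin n → ℝ}
    (h : HasFDerivAt f L p) (i : Fin n) : pd i f p = L (Pi.single i 1) := by
  have h' : HasFDerivAt f L (Function.update p i (p i)) := by rwa [Function.update_eq_self]
  exact (h'.comp_hasDerivAt (p i) (hasDerivAt_update p i (p i))).deriv

section Differentials

variable {p : Params}

lemma hasFDerivAt_coord (p : Params) (i : Fin 3) :
    HasFDerivAt (fun q : Params => q i) (ContinuousLinearMap.proj (R := ℝ) i) p :=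
  hasFDerivAt_apply i p

lemma hasFDerivAt_exp_neg (p : Params) :
    HasFDerivAt (fun q : Params => Real.exp (-q 2))
      (Real.exp (-p 2) • -ContinuousLinearMap.proj (R := ℝ) (2 : Fin 3)) p :=
  (hasFDerivAt_coord p 2).fun_neg.exp

/-- A_H / 4 = 2π m r_H on an open set, where the square root d = √(m² - a²) is positive and
differentiable. The coefficient of δm simplifies by r_H d + m d + m² = r_H². -/
lemma exists_hasFDerivAt_quarterArea (hp : p ∈ blackHoles) :
    ∃ L : Params →L[ℝ] ℝ, HasFDerivAt (fun q => horizonArea q / 4) L p ∧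
      ∀ v, L v = 2 * Real.pi / Real.sqrt (p 0 ^ 2 - p 1 ^ 2)
        * (horizonRadius p ^ 2 * v 0 - p 0 * p 1 * v 1) := by
  have hd := sqrt_pos_of_blackHole hp
  have h0 := hasFDerivAt_coord p 0
  have h1 := hasFDerivAt_coord p 1
  have hr := h0.fun_add (((h0.fun_mul h0).fun_sub (h1.fun_mul h1)).sqrt
    (by simpa only [sq] using (sub_pos.2 (sq_lt_sq_of_blackHole hp)).ne'))
  refine ⟨_, ((h0.fun_mul hr).const_mul (2 * Real.pi)).congr_of_eventuallyEq ?_, fun v => ?_⟩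
  · filter_upwards [isOpen_blackHoles.mem_nhds hp] with q hq
    rw [horizonArea_eq' hq, horizonRadius, sq, sq]
    ring
  · simp only [horizonRadius, ← sq]
    generalize Real.sqrt (p 0 ^ 2 - p 1 ^ 2) = d at *
    simp
    field_simp
    ring

lemma exists_hasFDerivAt_massCharge (G : ℝ) (p : Params) :
    ∃ L : Params →L[ℝ] ℝ, HasFDerivAt (massCharge G) L p ∧
      ∀ v, L v = Real.exp (-p 2) / G * (v 0 - p 0 * v 2) := by
  refine ⟨_, ((hasFDerivAt_coord p 0).fun_mul (hasFDerivAt_exp_neg p)).mul_const G⁻¹, fun v => ?_⟩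
  simp
  ring

lemma exists_hasFDerivAt_angularMomentum (G : ℝ) (p : Params) :
    ∃ L : Params →L[ℝ] ℝ, HasFDerivAt (angularMomentum G) L p ∧
      ∀ v, L v = Real.exp (-p 2) / G * (p 1 * v 0 + p 0 * v 1 - p 0 * p 1 * v 2) := by
  refine ⟨_, (((hasFDerivAt_coord p 0).fun_mul (hasFDerivAt_coord p 1)).fun_mul
    (hasFDerivAt_exp_neg p)).mul_const G⁻¹, fun v => ?_⟩
  simp
  ring

lemma exists_hasFDerivAt_entropy (G : ℝ) (hp : p ∈ blackHoles) :
    ∃ L : Params →L[ℝ] ℝ, HasFDerivAt (entropy G) L p ∧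
      ∀ v, L v = Real.exp (-p 2) / G * (pd 0 (fun q => horizonArea q / 4) p * v 0
        + pd 1 (fun q => horizonArea q / 4) p * v 1 - horizonArea p / 4 * v 2) := by
  obtain ⟨L, hL, hLv⟩ := exists_hasFDerivAt_quarterArea hp
  have h := (hL.fun_mul (hasFDerivAt_exp_neg p)).mul_const G⁻¹
  refine ⟨_, h.congr_of_eventuallyEq (Eventually.of_forall fun q => ?_), fun v => ?_⟩
  · simp only [entropy]; ring
  · rw [pd_of_hasFDerivAt hL, pd_of_hasFDerivAt hL]
    simp [hLv]
    ring

/-- The entropy variation is fixed by the first law. -/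
lemma entropy_form (hp : p ∈ blackHoles) (v : Params) :
    pd 0 (fun q => horizonArea q / 4) p * v 0 + pd 1 (fun q => horizonArea q / 4) p * v 1
        - horizonArea p / 4 * v 2
      = 2 * Real.pi / surfaceGravity p * ((v 0 - p 0 / 2 * v 2)
        - angularVelocityH p * (p 1 * v 0 + p 0 * v 1 - p 0 * p 1 * v 2)) := by
  obtain ⟨L, hL, hLv⟩ := exists_hasFDerivAt_quarterArea hp
  have hm := (mass_pos hp).ne'
  have hr := (horizonRadius_pos hp).ne'
  have hd := (sqrt_pos_of_blackHole hp).ne'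
  have e := horizonRadius_sq hp
  have er : horizonRadius p = p 0 + Real.sqrt (p 0 ^ 2 - p 1 ^ 2) := rfl
  rw [pd_of_hasFDerivAt hL, pd_of_hasFDerivAt hL, hLv, hLv, horizonArea_eq' hp, surfaceGravity,
    angularVelocityH]
  simp
  generalize Real.sqrt (p 0 ^ 2 - p 1 ^ 2) = d at *
  generalize horizonRadius p = r at *
  field_simp
  -- The δa coefficients agree outright and δm needs only Δ(r_H) = 0. The δφ_∞ coefficient is the
  -- Smarr relation T_H S_H = M/2 - Ω_H J, which also uses r_H = m + √(m² - a²).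
  linear_combination (8 * v 0 - 8 * p 0 * v 2) * e + 8 * p 0 * v 2 * r * er

end Differentials

/-! ### Potentials -/

section Potentials

variable {F : Params → Params → ℝ} {V : Submodule ℝ Params} {U : Set Params} {H : Params → ℝ}

lemma isPotentialAlong_of_hasFDerivAt
    (h : ∀ p ∈ U, ∃ L : Params →L[ℝ] ℝ, HasFDerivAt H L p ∧ ∀ v ∈ V, L v = F p v) :
    IsPotentialAlong F V U H := by
  intro p hp
  obtain ⟨L, hL, hLv⟩ := h p hp
  refine ⟨L.comp V.subtypeL, fun v => hLv v v.2, ?_⟩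
  have hadd : HasFDerivAt (fun v : V => p + (v : Params)) V.subtypeL 0 :=
    V.subtypeL.hasFDerivAt.const_add p
  have hL' : HasFDerivAt H L (p + ((0 : V) : Params)) := by simpa using hL
  exact hL'.comp (0 : V) hadd

lemma IsPotentialAlong.congr {H' : Params → ℝ} (h : IsPotentialAlong F V U H) (hU : IsOpen U)
    (hH : EqOn H' H U) : IsPotentialAlong F V U H' := by
  intro p hp
  obtain ⟨L, hL, hd⟩ := h p hp
  refine ⟨L, hL, hd.congr_of_eventuallyEq ?_⟩
  have hc : Continuous fun v : V => p + (v : Params) := by fun_prop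
  filter_upwards [hc.continuousAt.eventually_mem (x := 0) (hU.mem_nhds (by simpa using hp))]
    with v hv
  exact hH hv

/-- Restriction of a potential to an affine subspace in the direction of `V`. -/
lemma IsPotentialAlong.comp_affine {E : Type*} [NormedAddCommGroup E] [NormedSpace ℝ E]
    (h : IsPotentialAlong F V U H) (ι : E →L[ℝ] Params) (hι : ∀ e, ι e ∈ V) {b : Params} {e₀ : E}
    (he : b + ι e₀ ∈ U) : ∃ L : E →L[ℝ] ℝ, (∀ e, L e = F (b + ι e₀) (ι e)) ∧
      HasFDerivAt (fun e => H (b + ι e)) L e₀ := by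
  obtain ⟨L, hL, hd⟩ := h _ he
  let κ : E →L[ℝ] V := ι.codRestrict V hι
  -- Potentials are differentiated at displacement 0 from the base point, so the argument is
  -- recentred at `e₀`.
  have hκ : HasFDerivAt (fun e => κ e - κ e₀) κ e₀ := κ.hasFDerivAt.sub_const _
  have hd' : HasFDerivAt (fun v : V => H (b + ι e₀ + v)) L (κ e₀ - κ e₀) := by rwa [sub_self]
  refine ⟨L.comp κ, fun e => hL (κ e), ?_⟩
  refine (hd'.comp e₀ hκ).congr_of_eventuallyEq (Eventually.of_forall fun e => ?_)
  simp [κ]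

end Potentials

lemma mem_fixedModulus {v : Params} : v ∈ fixedModulus ↔ v 2 = 0 := by
  simp [fixedModulus, variationsOf, Submodule.mem_pi, Fin.forall_fin_succ]

/-! ### Uniqueness of finite charges on the wedge |a| < m -/

section Uniqueness

/-- The black hole range in the `(m, a)` plane. -/
lemma isOpen_wedge : IsOpen {q : ℝ × ℝ | |q.2| < q.1} := isOpen_lt continuous_snd.abs continuous_fst

lemma convex_wedge : Convex ℝ {q : ℝ × ℝ | |q.2| < q.1} := by
  refine convex_iff_forall_pos.2 fun x hx y hy s t hs ht _ => ?_
  simp only [mem_ofPred_eq, abs_lt] at *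
  simp only [Prod.snd_add, Prod.fst_add, Prod.smul_fst, Prod.smul_snd, smul_eq_mul]
  constructor <;> nlinarith

/-- The origin is approached along a = 0, m ↓ 0. Without this the normalisation at flat spacetime
would be vacuous. -/
lemma wedge_neBot : (𝓝[{q : ℝ × ℝ | |q.2| < q.1}] 0).NeBot := by
  refine mem_closure_iff_nhdsWithin_neBot.1 ?_
  have hc : ContinuousWithinAt (fun s : ℝ => ((s, 0) : ℝ × ℝ)) (Ioi 0) 0 :=
    (by fun_prop : Continuous fun s : ℝ => ((s, 0) : ℝ × ℝ)).continuousWithinAt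
  have h0 : (0 : ℝ) ∈ closure (Ioi (0 : ℝ)) := by rw [closure_Ioi]; exact self_mem_Ici
  exact hc.mem_closure h0 fun s hs => by simpa using hs

/-- Two finite charges with the same variation agree. -/
lemma IsFiniteCharge.eqOn {F : Params → Params → ℝ} {H H' : Params → ℝ} (h : IsFiniteCharge F H)
    (h' : IsFiniteCharge F H') : EqOn H H' blackHoles := by
  intro p hp
  set T := {q : ℝ × ℝ | |q.2| < q.1} with hT
  let ι : ℝ × ℝ →L[ℝ] Params := ContinuousLinearMap.pi
    ![ContinuousLinearMap.fst ℝ ℝ ℝ, ContinuousLinearMap.snd ℝ ℝ ℝ, 0]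
  have hι : ∀ e, ι e ∈ fixedModulus := fun e => mem_fixedModulus.2 (by simp [ι])
  have hb : ∀ q : ℝ × ℝ, ![0, 0, p 2] + ι q = ![q.1, q.2, p 2] := fun q => by
    ext i; fin_cases i <;> simp [ι]
  let f : ℝ × ℝ → ℝ := fun q => H ![q.1, q.2, p 2] - H' ![q.1, q.2, p 2]
  have hf : ∀ q ∈ T, HasFDerivAt f 0 q := fun q hq => by
    have hq' : ![0, 0, p 2] + ι q ∈ blackHoles := by rw [hb]; exact hq
    obtain ⟨L, hL, hd⟩ := h.1.comp_affine ι hι hq'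
    obtain ⟨L', hL', hd'⟩ := h'.1.comp_affine ι hι hq'
    -- Both derivatives are the same one-form, so the difference of the two charges is locally
    -- constant on the wedge. Connectedness makes it constant, and the limit at the origin makes it
    -- zero.
    have hLL : L - L' = 0 := by
      ext <;> simp [hL, hL']
    rw [← hLL]
    have := hd.fun_sub hd'
    simpa only [hb] using this
  obtain ⟨c, hc⟩ := isOpen_wedge.exists_is_const_of_fderiv_eq_zero (𝕜 := ℝ) (f := f)
    convex_wedge.isPreconnected (fun q hq => (hf q hq).differentiableAt.differentiableWithinAt)
    (fun q hq => (hf q hq).fderiv)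
  have hlim : Tendsto f (𝓝[T] 0) (𝓝 0) := by simpa using (h.2 (p 2)).sub (h'.2 (p 2))
  have hlim' : Tendsto f (𝓝[T] 0) (𝓝 c) := by
    refine tendsto_const_nhds.congr' ?_
    filter_upwards [self_mem_nhdsWithin] with q hq using (hc q hq).symm
  have := wedge_neBot
  have hc0 : c = 0 := tendsto_nhds_unique hlim' hlim
  have hpf := hc (p 0, p 1) hp
  have hpe : ![p 0, p 1, p 2] = p := by ext i; fin_cases i <;> rfl
  simp only [f, hpe, hc0] at hpf
  linarith

lemma IsFiniteCharge.congr {F : Params → Params → ℝ} {H H' : Params → ℝ} (h : IsFiniteCharge F H)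
    (hH : EqOn H' H blackHoles) : IsFiniteCharge F H' := by
  refine ⟨h.1.congr isOpen_blackHoles hH, fun c => (h.2 c).congr' ?_⟩
  filter_upwards [self_mem_nhdsWithin] with q hq
  exact (hH (x := ![q.1, q.2, c]) hq).symm

lemma isFiniteCharge_iff {F : Params → Params → ℝ} {H₀ : Params → ℝ} (h : IsFiniteCharge F H₀)
    (H : Params → ℝ) : IsFiniteCharge F H ↔ EqOn H H₀ blackHoles :=
  ⟨fun hH => hH.eqOn h, fun hH => h.congr hH⟩

end Uniqueness

/-! ### The charges of the Kerr family -/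

section Charges

variable {G : ℝ} {T R : Params → ℝ} {p : Params}

/-- The three charges are one linear formula in (u, w), evaluated at (1, 0), (0, -1) and (2π/κ_H)(1,
Ω_H). -/
lemma massVariation_eq (hp : p ∈ blackHoles) (hR : horizonRadius p < R p) (δp : Params) :
    massVariation G T R p δp = Real.exp (-p 2) / G * (δp 0 - p 0 / 2 * δp 2) := by
  have := chargeVariation_kerr hp δp G 1 0 (T p) hR
  rw [one_mul, zero_mul, sub_zero] at this
  exact this

lemma angularMomentumVariation_eq (hp : p ∈ blackHoles) (hR : horizonRadius p < R p)
    (δp : Params) : angularMomentumVariation G T R p δp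
      = Real.exp (-p 2) / G * (p 1 * δp 0 + p 0 * δp 1 - p 0 * p 1 * δp 2) := by
  have := chargeVariation_kerr hp δp G 0 (-1) (T p) hR
  rw [zero_mul, zero_sub, neg_one_mul, neg_neg] at this
  exact this

lemma entropyVariation_eq (hp : p ∈ blackHoles) (hR : horizonRadius p < R p) (δp : Params) :
    entropyVariation G T R p δp = Real.exp (-p 2) / G *
      (pd 0 (fun q => horizonArea q / 4) p * δp 0 + pd 1 (fun q => horizonArea q / 4) p * δp 1
        - horizonArea p / 4 * δp 2) := by
  rw [entropy_form hp]
  refine (chargeVariation_kerr hp δp G _ _ (T p) hR).trans ?_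
  ring

/-- The first law for the charge variations. -/
theorem firstLaw_variations (hp : p ∈ blackHoles) (hR : horizonRadius p < R p) (δp : Params) :
    temperature p * entropyVariation G T R p δp = massVariation G T R p δp
      - (angularVelocityH p - angularVelocityInfty p) * angularMomentumVariation G T R p δp := by
  have hκ : surfaceGravity p ≠ 0 := by
    have h1 := mass_pos hp
    have h2 := horizonRadius_pos hp
    have h3 := sqrt_pos_of_blackHole hp
    unfold surfaceGravity; positivity
  rw [entropyVariation_eq hp hR, massVariation_eq hp hR, angularMomentumVariation_eq hp hR,
    entropy_form hp, temperature, angularVelocityInfty]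
  field_simp
  ring

/-- The first law for the finite charges. -/
theorem firstLaw_charges (G : ℝ) (hp : p ∈ blackHoles) :
    DifferentiableAt ℝ (entropy G) p ∧ DifferentiableAt ℝ (massCharge G) p ∧
    DifferentiableAt ℝ (angularMomentum G) p ∧
    ∀ δp : Params, δp 2 = 0 → temperature p * fderiv ℝ (entropy G) p δp
      = fderiv ℝ (massCharge G) p δp
        - (angularVelocityH p - angularVelocityInfty p) * fderiv ℝ (angularMomentum G) p δp := by
  obtain ⟨LM, hM, hMv⟩ := exists_hasFDerivAt_massCharge G p
  obtain ⟨LJ, hJ, hJv⟩ := exists_hasFDerivAt_angularMomentum G p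
  obtain ⟨LS, hS, hSv⟩ := exists_hasFDerivAt_entropy G hp
  refine ⟨hS.differentiableAt, hM.differentiableAt, hJ.differentiableAt, fun v hv => ?_⟩
  -- The finite charges refer to no sphere, so any admissible radius serves to import the law for
  -- variations.
  have hR : horizonRadius p < horizonRadius p + 1 := by linarith
  have key := firstLaw_variations (G := G) (T := 0) (R := fun q => horizonRadius q + 1) hp hR v
  rw [entropyVariation_eq hp hR, massVariation_eq hp hR, angularMomentumVariation_eq hp hR] at key
  rw [hS.fderiv, hM.fderiv, hJ.fderiv, hSv, hMv, hJv, key, hv]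
  ring

end Charges

/-! ### Integrability and the selection of parameters -/

section Integrability

variable {G : ℝ} {T R : Params → ℝ} {V : Submodule ℝ Params} {U : Set Params}

lemma isPotentialAlong_massCharge (hR : ∀ p ∈ blackHoles, horizonRadius p < R p)
    (hU : U ⊆ blackHoles) (hV : ∀ v ∈ V, v 2 = 0) :
    IsPotentialAlong (massVariation G T R) V U (massCharge G) := by
  refine isPotentialAlong_of_hasFDerivAt fun p hp => ?_
  obtain ⟨L, hL, hLv⟩ := exists_hasFDerivAt_massCharge G p
  refine ⟨L, hL, fun v hv => ?_⟩
  rw [hLv, massVariation_eq (hU hp) (hR p (hU hp)), hV v hv]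
  ring

lemma isPotentialAlong_angularMomentum (hR : ∀ p ∈ blackHoles, horizonRadius p < R p)
    (hU : U ⊆ blackHoles) :
    IsPotentialAlong (angularMomentumVariation G T R) V U (angularMomentum G) := by
  refine isPotentialAlong_of_hasFDerivAt fun p hp => ?_
  obtain ⟨L, hL, hLv⟩ := exists_hasFDerivAt_angularMomentum G p
  refine ⟨L, hL, fun v _ => ?_⟩
  rw [hLv, angularMomentumVariation_eq (hU hp) (hR p (hU hp))]

lemma isPotentialAlong_entropy (hR : ∀ p ∈ blackHoles, horizonRadius p < R p)
    (hU : U ⊆ blackHoles) : IsPotentialAlong (entropyVariation G T R) V U (entropy G) := by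
  refine isPotentialAlong_of_hasFDerivAt fun p hp => ?_
  obtain ⟨L, hL, hLv⟩ := exists_hasFDerivAt_entropy G (hU hp)
  refine ⟨L, hL, fun v _ => ?_⟩
  rw [hLv, entropyVariation_eq (hU hp) (hR p (hU hp))]

/-- The mixed second derivatives of a potential of the mass variation disagree if `δφ_∞ ≠ 0`. -/
lemma modulus_eq_zero_of_integrable (hG : 0 < G) (hR : ∀ p ∈ blackHoles, horizonRadius p < R p)
    (hUo : IsOpen U) (hUn : U.Nonempty) (hU : U ⊆ blackHoles)
    (hV : (Pi.single 0 1 : Params) ∈ V) (h : IntegrableAlong (massVariation G T R) V U)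
    {v : Params} (hv : v ∈ V) : v 2 = 0 := by
  obtain ⟨H, hH⟩ := h
  obtain ⟨p, hp⟩ := hUn
  -- The potential is restricted to the plane through `p` spanned by the variation of m and by `v`.
  -- Below, `A` and `B` are its two partial derivatives there.
  let ι : ℝ × ℝ →L[ℝ] Params :=
    (ContinuousLinearMap.fst ℝ ℝ ℝ).smulRight (Pi.single 0 1 : Params)
      + (ContinuousLinearMap.snd ℝ ℝ ℝ).smulRight v
  have hι : ∀ e, ι e ∈ V := fun e => V.add_mem (V.smul_mem _ hV) (V.smul_mem _ hv)
  have hι0 : ∀ e, ι e 0 = e.1 + e.2 * v 0 := fun e => by simp [ι]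
  have hι2 : ∀ e, ι e 2 = e.2 * v 2 := fun e => by simp [ι]
  let A : ℝ × ℝ → ℝ := fun e => Real.exp (-(p 2 + e.2 * v 2)) / G
  let B : ℝ × ℝ → ℝ := fun e => A e * (v 0 - (p 0 + (e.1 + e.2 * v 0)) / 2 * v 2)
  let f' : ℝ × ℝ → ℝ × ℝ →L[ℝ] ℝ := fun e =>
    A e • ContinuousLinearMap.fst ℝ ℝ ℝ + B e • ContinuousLinearMap.snd ℝ ℝ ℝ
  have hf : ∀ᶠ e in 𝓝 (0 : ℝ × ℝ), HasFDerivAt (fun e => H (p + ι e)) (f' e) e := by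
    have hc : Continuous fun e => p + ι e := by fun_prop
    filter_upwards [hc.continuousAt.eventually_mem (x := 0) (hUo.mem_nhds (by simpa using hp))]
      with e he
    obtain ⟨L, hL, hd⟩ := hH.comp_affine ι hι he
    have hL' : f' e = L := ContinuousLinearMap.ext fun e' => by
      rw [hL, massVariation_eq (hU he) (hR _ (hU he))]
      simp only [Pi.add_apply, hι0, hι2]
      simp [f', A, B]
      ring
    rwa [hL']
  have h1 : HasFDerivAt (fun e : ℝ × ℝ => e.1) (ContinuousLinearMap.fst ℝ ℝ ℝ) 0 := hasFDerivAt_fst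
  have h2 : HasFDerivAt (fun e : ℝ × ℝ => e.2) (ContinuousLinearMap.snd ℝ ℝ ℝ) 0 := hasFDerivAt_snd
  have hA := (((h2.mul_const (v 2)).const_add (p 2)).fun_neg.exp).mul_const G⁻¹
  have hB := hA.fun_mul ((((h1.fun_add (h2.mul_const (v 0))).const_add (p 0)).mul_const
    (2⁻¹)).mul_const (v 2) |>.const_sub (v 0))
  have hf' := (hA.smul_const (ContinuousLinearMap.fst ℝ ℝ ℝ)).fun_add
    (hB.smul_const (ContinuousLinearMap.snd ℝ ℝ ℝ))
  -- The mixed derivatives at the origin are -v₂ e^{-φ_∞}/G and -(v₂/2) e^{-φ_∞}/G. Equality forces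
  -- v₂ = 0.
  have hsymm := second_derivative_symmetric_of_eventually hf hf' (1, 0) (0, 1)
  simp at hsymm
  have hE : Real.exp (-p 2) * G⁻¹ ≠ 0 := by positivity
  refine (mul_eq_zero.1 ?_).resolve_left hE
  linarith

lemma isFiniteCharge_massCharge (hR : ∀ p ∈ blackHoles, horizonRadius p < R p) :
    IsFiniteCharge (massVariation G T R) (massCharge G) := by
  refine ⟨isPotentialAlong_massCharge hR subset_rfl fun v hv => mem_fixedModulus.1 hv, fun c => ?_⟩
  have hc : Continuous fun q : ℝ × ℝ => q.1 * Real.exp (-c) / G := by fun_prop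
  have := (hc.tendsto 0).mono_left (nhdsWithin_le_nhds (s := {q : ℝ × ℝ | |q.2| < q.1}))
  simpa [massCharge] using this

lemma isFiniteCharge_angularMomentum (hR : ∀ p ∈ blackHoles, horizonRadius p < R p) :
    IsFiniteCharge (angularMomentumVariation G T R) (angularMomentum G) := by
  refine ⟨isPotentialAlong_angularMomentum hR subset_rfl, fun c => ?_⟩
  have hc : Continuous fun q : ℝ × ℝ => q.1 * q.2 * Real.exp (-c) / G := by fun_prop
  have := (hc.tendsto 0).mono_left (nhdsWithin_le_nhds (s := {q : ℝ × ℝ | |q.2| < q.1}))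
  simpa [angularMomentum] using this

lemma isFiniteCharge_entropy (hR : ∀ p ∈ blackHoles, horizonRadius p < R p) :
    IsFiniteCharge (entropyVariation G T R) (entropy G) := by
  refine ⟨isPotentialAlong_entropy hR subset_rfl, fun c => ?_⟩
  -- The closed form of the area is continuous on the whole plane. It agrees with the integral
  -- inside the wedge, where the limit is taken.
  have hc : Continuous fun q : ℝ × ℝ => 8 * Real.pi * q.1 * (q.1 + Real.sqrt (q.1 ^ 2 - q.2 ^ 2))
      * Real.exp (-c) / (4 * G) := by fun_prop
  have h0 := (hc.tendsto 0).mono_left (nhdsWithin_le_nhds (s := {q : ℝ × ℝ | |q.2| < q.1}))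
  simp only [Prod.fst_zero, mul_zero, zero_mul, zero_div] at h0
  refine h0.congr' ?_
  filter_upwards [self_mem_nhdsWithin] with q hq
  have hq' : ![q.1, q.2, c] ∈ blackHoles := hq
  rw [entropy, horizonArea_eq' hq']
  simp [horizonRadius]

lemma integrabilityCondition_fixedModulus (hR : ∀ p ∈ blackHoles, horizonRadius p < R p)
    {i : Fin 3} (hi : i ∈ ({0, 1} : Set (Fin 3))) :
    IntegrabilityCondition (firstLawVariations G T R) {0, 1} i := by
  intro k
  rw [insert_eq_of_mem hi]
  fin_cases k
  · exact ⟨_, (isFiniteCharge_massCharge hR).1⟩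
  · exact ⟨_, (isFiniteCharge_angularMomentum hR).1⟩
  · exact ⟨_, (isFiniteCharge_entropy hR).1⟩

/-- The mass detects m, with coefficient e^{-φ_∞}/G. It has no δa term, so a is detected by the
angular momentum, with coefficient m e^{-φ_∞}/G. -/
lemma contributionCondition_fixedModulus (hG : 0 < G)
    (hR : ∀ p ∈ blackHoles, horizonRadius p < R p) {i : Fin 3} (hi : i ∈ ({0, 1} : Set (Fin 3))) :
    ContributionCondition (firstLawVariations G T R) {0, 1} i := by
  have hint := integrabilityCondition_fixedModulus (G := G) (T := T) hR hi
  rcases hi with rfl | rfl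
  · refine ⟨0, hint 0, fun p hp => ?_⟩
    change massVariation G T R p _ ≠ 0
    rw [massVariation_eq hp (hR p hp)]
    simpa using hG.ne'
  · refine ⟨1, hint 1, fun p hp => ?_⟩
    change angularMomentumVariation G T R p _ ≠ 0
    rw [angularMomentumVariation_eq hp (hR p hp)]
    simpa using ⟨hG.ne', (mass_pos hp).ne'⟩

/-- With all three parameters free, both the variation of m and that of φ_∞ are allowed, so the mass
alone is an obstruction. -/
lemma not_integrabilityCondition_modulus (hG : 0 < G)
    (hR : ∀ p ∈ blackHoles, horizonRadius p < R p) :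
    ¬ IntegrabilityCondition (firstLawVariations G T R) {0, 1} 2 := by
  intro h
  have hmem : ∀ v : Params, v ∈ variationsOf (insert 2 {0, 1}) := fun v => by
    simp [variationsOf, Submodule.mem_pi, Fin.forall_fin_succ]
  have hne : blackHoles.Nonempty := ⟨![1, 0, 0], by simp [blackHoles]⟩
  have := modulus_eq_zero_of_integrable hG hR isOpen_blackHoles hne subset_rfl (hmem _) (h 0)
    (hmem (Pi.single 2 1))
  simp at this

end Integrability

end EinsteinDilaton

end

/-- `T` and `R` choose the sphere for each parameter value. Independence of the sphere is expressed
by their absence from the explicit charge variations. -/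
theorem mainTheorem2 (G : ℝ) (hG : 0 < G) (T R : Params → ℝ)
    (hR : ∀ p ∈ blackHoles, horizonRadius p < R p) :
    -- the Kerr fields solve the equations of motion, and the generators are exact symmetries
    (∀ p ∈ blackHoles,
      (kerr p).SolvesEOM G (exterior p) ∧
      (kerr p).IsExactSymmetry (genM p) (exterior p) ∧
      (kerr p).IsExactSymmetry (genJ p) (exterior p) ∧
      (kerr p).IsExactSymmetry (genS p) (exterior p)) ∧
    -- angular velocities, surface gravity and area of the horizon
    (∀ p ∈ blackHoles,
      HasAngularVelocity p (𝓝[>] horizonRadius p) (angularVelocityH p) ∧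
      HasAngularVelocity p atTop (angularVelocityInfty p) ∧
      HasHorizonSurfaceGravity p (stationaryAxial 1 (angularVelocityH p)) (surfaceGravity p) ∧
      horizonArea p = 4 * Real.pi * (horizonRadius p ^ 2 + p 1 ^ 2) ∧
      horizonArea p = 8 * Real.pi * p 0 * horizonRadius p) ∧
    -- explicit parametric charge variations, for `δp = (δm, δa, δφ_∞)`
    (∀ p ∈ blackHoles, ∀ δp : Params,
      ParamChargeConverges G genM T R p δp ∧
      ParamChargeConverges G genJ T R p δp ∧
      ParamChargeConverges G genS T R p δp ∧
      massVariation G T R p δp = Real.exp (-p 2) / G * (δp 0 - p 0 / 2 * δp 2) ∧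
      angularMomentumVariation G T R p δp =
        Real.exp (-p 2) / G * (p 1 * δp 0 + p 0 * δp 1 - p 0 * p 1 * δp 2) ∧
      entropyVariation G T R p δp =
        Real.exp (-p 2) / G *
          (pd 0 (fun q => horizonArea q / 4) p * δp 0
            + pd 1 (fun q => horizonArea q / 4) p * δp 1 - horizonArea p / 4 * δp 2)) ∧
    -- once `m` is varied, the mass is not integrable, on any open set, unless `δφ_∞ = 0`
    (∀ U : Set Params, IsOpen U → U.Nonempty → U ⊆ blackHoles →
      ∀ V : Submodule ℝ Params, Pi.single 0 1 ∈ V →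
        (IntegrableAlong (massVariation G T R) V U ↔ ∀ v ∈ V, v 2 = 0)) ∧
    -- so `φ_∞` is rejected by the first condition, while `m` and `a` pass both conditions
    ¬ IntegrabilityCondition (firstLawVariations G T R) {0, 1} 2 ∧
    (∀ i ∈ ({0, 1} : Set (Fin 3)),
      IntegrabilityCondition (firstLawVariations G T R) {0, 1} i ∧
      ContributionCondition (firstLawVariations G T R) {0, 1} i) ∧
    -- the finite charges obtained for `δφ_∞ = 0`
    (∀ H : Params → ℝ,
      (IsFiniteCharge (massVariation G T R) H ↔ Set.EqOn H (massCharge G) blackHoles) ∧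
      (IsFiniteCharge (angularMomentumVariation G T R) H ↔
        Set.EqOn H (angularMomentum G) blackHoles) ∧
      (IsFiniteCharge (entropyVariation G T R) H ↔ Set.EqOn H (entropy G) blackHoles)) ∧
    -- first law for the charge variations
    (∀ p ∈ blackHoles, ∀ δp : Params,
      temperature p * entropyVariation G T R p δp =
        massVariation G T R p δp
          - (angularVelocityH p - angularVelocityInfty p) *
            angularMomentumVariation G T R p δp) ∧
    -- first law for the finite charges, without any contribution from `φ_∞`
    (∀ p ∈ blackHoles,
      DifferentiableAt ℝ (entropy G) p ∧ DifferentiableAt ℝ (massCharge G) p ∧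
      DifferentiableAt ℝ (angularMomentum G) p ∧
      ∀ δp : Params, δp 2 = 0 →
        temperature p * fderiv ℝ (entropy G) p δp =
          fderiv ℝ (massCharge G) p δp
            - (angularVelocityH p - angularVelocityInfty p) *
              fderiv ℝ (angularMomentum G) p δp) := by
  refine ⟨fun p hp => ⟨kerr_solvesEOM hp G, kerr_isExactSymmetry p _ _ _,
      kerr_isExactSymmetry p _ _ _, kerr_isExactSymmetry p _ _ _⟩,
    fun p hp => ⟨hasAngularVelocity_horizon hp, hasAngularVelocity_infinity hp,
      hasHorizonSurfaceGravity hp, horizonArea_eq hp, horizonArea_eq' hp⟩,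
    fun p hp δp => ⟨integrableOn_sphereIntegrand hp δp G _ _ _ (hR p hp),
      integrableOn_sphereIntegrand hp δp G _ _ _ (hR p hp),
      integrableOn_sphereIntegrand hp δp G _ _ _ (hR p hp),
      massVariation_eq hp (hR p hp) δp, angularMomentumVariation_eq hp (hR p hp) δp,
      entropyVariation_eq hp (hR p hp) δp⟩,
    fun U hUo hUn hU V hV => ⟨fun h v hv =>
      modulus_eq_zero_of_integrable hG hR hUo hUn hU hV h hv,
      fun h => ⟨_, isPotentialAlong_massCharge hR hU h⟩⟩,
    not_integrabilityCondition_modulus hG hR,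
    fun i hi => ⟨integrabilityCondition_fixedModulus hR hi,
      contributionCondition_fixedModulus hG hR hi⟩,
    fun H => ⟨isFiniteCharge_iff (isFiniteCharge_massCharge hR) H,
      isFiniteCharge_iff (isFiniteCharge_angularMomentum hR) H,
      isFiniteCharge_iff (isFiniteCharge_entropy hR) H⟩,
    fun p hp δp => firstLaw_variations hp (hR p hp) δp,
    fun p hp => firstLaw_charges G hp⟩
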